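/- Let $\mathcal X,\mathcal Y$ be finite sets, let $0\in\mathcal X$ be a distinguished ("off") input symbol, and let $W(\cdot|x)$, $x\in\mathcal X$, be probability distributions on $\mathcal Y$ (a discrete memoryless channel). Put $Q_0=W(\cdot|0)$ and $W^{n}(y^n|x^n)=\prod_{i=1}^n W(y_i|x_i)$. All logarithms are natural, and $D(\cdot\|\cdot)$ denotes relative entropy. A (deterministic) code of blocklength $n$ for a finite non-empty message set $\mathcal M$ is a pair of an encoder $\mathcal M\to\mathcal X^n$ and a decoder $\mathcal Y^n\to\mathcal M$; a random code is a probability distribution on the set of such codes. A random code, together with an independent message $M$ uniform on $\mathcal M$ whose codeword is sent through $W^n$ and whose output is decoded by the same code, induces a distribution $Q^n$ on $\mathcal Y^n$ and an average error probability $\Pr[\hat M\ne M]$. For $\delta>0$ and $0<\epsilon<1$ let $K_n(\delta,\epsilon)$ be the maximum of $\log|\mathcal M|$ over all random codes of blocklength $n$ such that $D(Q^n\|Q_0^{\times n})\le\delta$ and the average error probability is at most $\epsilon$, and let $$L=\lim_{\epsilon\downarrow0}\ \liminf_{n\to\infty}\ \frac{K_n(\delta,\epsilon)}{\sqrt{n\delta}}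 .$$ Assume that $Q_0(y)>0$ for every $y\in\mathcal Y$, that $0$ is not redundant, i.e. $Q_0$ is not in the convex hull of $\{W(\cdot|x):x\in\mathcal X,\ x\neq0\}$, and that $\mathcal X$ contains at least one symbol other than $0$. Then, for every $\delta>0$, the limit $L$ exists, is positive and finite, does not depend on $\delta$, and $$L=\max_{\tilde P:\ \tilde P(0)=0}\ \frac{\sum_{x\in\mathcal X}\tilde P(x)\,D\big(W(\cdot|x)\,\big\|\,Q_0\big)}{\sqrt{\dfrac12\sum_{y\in\mathcal Y}\dfrac{\big(\tilde Q(y)-Q_0(y)\big)^2}{Q_0(y)}}},$$ where the maximum, which is attained, is over probability distributions $\tilde P$ on $\mathcal X$ with $\tilde P(0)=0$, and $\tilde Q(y)=\sum_{x\in\mathcal X}\tilde P(x)W(y|x)$ is the output distribution induced by $\tilde P$. -/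

import Mathlib

open Filter Topology
open scoped ENNReal

noncomputable section

namespace LPD

/-- The relative entropy `D(p ‖ q)` in nats, with values in `[0, ∞]`; the alphabet carries the
discrete σ-algebra. -/
def relEntropy {α : Type*} (p q : PMF α) : ℝ≥0∞ :=
  letI : MeasurableSpace α := ⊤
  InformationTheory.klDiv p.toMeasure q.toMeasure

/-- The product of the distributions `p i`: the law of a sequence with independent entries. -/
def prodPMF {Y : Type*} [Fintype Y] {n : ℕ} (p : Fin n → PMF Y) : PMF (Fin n → Y) :=
  PMF.ofFintype (fun y => ∏ i, p i (y i)) (by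
    have h : ∀ i, ∑ y, p i y = 1 := fun i =>
      (tsum_fintype (fun y => p i y)).symm.trans (p i).tsum_coe
    classical
    rw [← Fintype.prod_sum (fun i y => p i y)]
    simp [h])

/-- A channel with input alphabet `X` and output alphabet `Y`, used without memory: the law of the
output sequence when the input sequence is `x`. -/
def memoryless {X Y : Type*} [Fintype Y] (W : X → PMF Y) {n : ℕ} (x : Fin n → X) :
    PMF (Fin n → Y) :=
  prodPMF fun i => W (x i)

/-- The input symbol `x` is redundant: `W(·|x)` is a mixture of the other output distributions. -/
def Redundant {X Y : Type*} (W : X → PMF Y) (x : X) : Prop :=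
  (fun y => (W x y).toReal) ∈
    convexHull ℝ {q : Y → ℝ | ∃ x', x' ≠ x ∧ q = fun y => (W x' y).toReal}

/-- A deterministic code of blocklength `n` for the message set `M`: an encoder and a decoder.
A random code is a probability distribution on deterministic codes. -/
abbrev Code (X Y M : Type*) (n : ℕ) : Type _ := (M → Fin n → X) × ((Fin n → Y) → M)

/-- The joint law of the message, the channel output sequence, and the decoded message, when a
code is drawn from `C` and, independently, a message is drawn uniformly. -/
def jointLaw {X Y M : Type*} [Fintype Y] [Fintype M] [Nonempty M] (W : X → PMF Y) {n : ℕ}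
    (C : PMF (Code X Y M n)) : PMF (M × (Fin n → Y) × M) :=
  C.bind fun c => (PMF.uniformOfFintype M).bind fun m =>
    (memoryless W (c.1 m)).map fun y => (m, y, c.2 y)

/-- The distribution on output sequences induced by a random code. -/
def outputLaw {X Y M : Type*} [Fintype Y] [Fintype M] [Nonempty M] (W : X → PMF Y) {n : ℕ}
    (C : PMF (Code X Y M n)) : PMF (Fin n → Y) :=
  (jointLaw W C).map fun t => t.2.1

/-- The average probability of a decoding error of a random code. -/
def errorProb {X Y M : Type*} [Fintype Y] [Fintype M] [Nonempty M] (W : X → PMF Y) {n : ℕ}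
    (C : PMF (Code X Y M n)) : ℝ≥0∞ :=
  (jointLaw W C).toOuterMeasure {t | t.2.2 ≠ t.1}

/-- There is a random code of blocklength `n` with `M` messages whose output distribution is
within relative entropy `δ` of the output distribution of the all-`x₀` input, and whose average
error probability is at most `ε`. -/
def Achievable {X Y : Type*} [Fintype Y] (W : X → PMF Y) (x₀ : X) (δ ε : ℝ) (n M : ℕ) : Prop :=
  ∃ (_ : NeZero M) (C : PMF (Code X Y (Fin M) n)),
    relEntropy (outputLaw W C) (prodPMF fun _ => W x₀) ≤ ENNReal.ofReal δ ∧
      errorProb W C ≤ ENNReal.ofReal ε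

/-- `K_n(δ, ε)`: the largest `log M` (in nats) over the achievable numbers `M` of messages. -/
def maxLogSize {X Y : Type*} [Fintype Y] (W : X → PMF Y) (x₀ : X) (n : ℕ) (δ ε : ℝ) : EReal :=
  sSup {k : EReal | ∃ M : ℕ, Achievable W x₀ δ ε n M ∧ k = ((Real.log M : ℝ) : EReal)}

/-- `L = lim_{ε ↓ 0} liminf_{n → ∞} K_n(δ, ε) / √(n δ)`: the limit exists and equals `L`. -/
def IsScalingConstant {X Y : Type*} [Fintype Y] (W : X → PMF Y) (x₀ : X) (δ : ℝ) (L : EReal) :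
    Prop :=
  Tendsto
    (fun ε : ℝ => liminf
      (fun n : ℕ => maxLogSize W x₀ n δ ε / ((Real.sqrt (n * δ) : ℝ) : EReal)) atTop)
    (𝓝[>] 0) (𝓝 L)

/-- The objective: `∑ₓ P(x) D(W(·|x) ‖ Q₀)` over `√(½ ∑_y (Q(y) - Q₀(y))² / Q₀(y))`, where
`Q₀ = W(·|x₀)` and `Q` is the output distribution induced by `P`. -/
def ratio {X Y : Type*} [Fintype X] [Fintype Y] (W : X → PMF Y) (x₀ : X) (P : PMF X) : ℝ :=
  (∑ x, (P x).toReal * (relEntropy (W x) (W x₀)).toReal) /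
    Real.sqrt (1 / 2 * ∑ y, ((P.bind W y).toReal - (W x₀ y).toReal) ^ 2 / (W x₀ y).toReal)

end LPD

end

open scoped MeasureTheory

noncomputable section

namespace LPD

set_option linter.unusedSectionVars false

/-! A relative entropy of order `δ` over `n` letters allows only about `√n` uses of symbols other
than the off symbol. On that scale the transmitted information is linear in the input weights `ν`
(through `gain`), while the output divergence is quadratic (through `cost`, half a `χ²`-distance).
The quotient of `gain` by the root of `cost` is therefore homogeneous of degree zero, and only the
direction of `ν` matters. Non-redundancy makes `cost` positive on the directions off `x₀`, so
compactness of the simplex gives a maximiser.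

Converse: two uses of the variational bound `mean_le_mean_log_add`. Testing with the event of
correct decoding bounds `log M` by the expected total gain of the codewords (`mul_log_card_le`).
Testing the output law with a sum of single-letter functions bounds the cost of the expected symbol
counts by about `n δ` (`two_mul_sqrt_cost_le`). Both bounds see a code only through these counts, so
neither needs any structure of the code, and the homogeneous inequality `sum_gain_le` joins them.

Achievability: codewords are drawn i.i.d. from a mixture that puts weight `α ~ 1/√n` on the optimal
`P` and the rest on `x₀`. The decoder compares the likelihood ratio against `Q₀^n` with a threshold
(`achievable_of_bounds`). Using `Q₀^n` instead of the true output law costs only a bounded factor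
`exp (2 n α² κ)`, where `κ` is the cost of `P`, which is negligible against exponents of order `√n`.
-/

lemma toReal_le_one {α : Type*} (p : PMF α) (a : α) : (p a).toReal ≤ 1 :=
  ENNReal.toReal_le_of_le_ofReal zero_le_one (by simpa using p.coe_le_one a)

lemma pmf_ext_toReal {α : Type*} {p q : PMF α} (h : ∀ a, (p a).toReal = (q a).toReal) : p = q :=
  PMF.ext fun a => (ENNReal.toReal_eq_toReal_iff' (p.apply_ne_top a) (q.apply_ne_top a)).1 (h a)

lemma bind_toReal {α β : Type*} [Fintype α] (p : PMF α) (k : α → PMF β) (b : β) :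
    (p.bind k b).toReal = ∑ a, (p a).toReal * (k a b).toReal := by
  rw [PMF.bind_apply, tsum_fintype, ENNReal.toReal_sum]
  · simp
  · exact fun a _ => ENNReal.mul_ne_top (p.apply_ne_top a) ((k a).apply_ne_top b)

/-! ### Expectations under finite distributions -/

section Mean

variable {α β : Type*} [Fintype α] [Fintype β]

/-- The expectation of a real function under a distribution on a finite type. -/
def mean (p : PMF α) (f : α → ℝ) : ℝ := ∑ a, (p a).toReal * f a

lemma sum_toReal (p : PMF α) : ∑ a, (p a).toReal = 1 := by
  rw [← ENNReal.toReal_sum (fun a _ => p.apply_ne_top a), ← tsum_fintype (L := .unconditional α),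
    p.tsum_coe, ENNReal.toReal_one]

@[simp] lemma mean_const (p : PMF α) (c : ℝ) : mean p (fun _ => c) = c := by
  simp [mean, ← Finset.sum_mul, sum_toReal]

lemma mean_add (p : PMF α) (f g : α → ℝ) : mean p (fun a => f a + g a) = mean p f + mean p g := by
  simp [mean, mul_add, Finset.sum_add_distrib]

lemma mean_sub (p : PMF α) (f g : α → ℝ) : mean p (fun a => f a - g a) = mean p f - mean p g := by
  simp [mean, mul_sub, Finset.sum_sub_distrib]

lemma mean_mul_left (p : PMF α) (c : ℝ) (f : α → ℝ) :
    mean p (fun a => c * f a) = c * mean p f := by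
  simp only [mean, Finset.mul_sum]
  exact Finset.sum_congr rfl fun a _ => by ring

lemma mean_mul_right (p : PMF α) (c : ℝ) (f : α → ℝ) :
    mean p (fun a => f a * c) = mean p f * c := by
  simp only [mean, Finset.sum_mul]
  exact Finset.sum_congr rfl fun a _ => by ring

lemma mean_sum {ι : Type*} (s : Finset ι) (p : PMF α) (f : ι → α → ℝ) :
    mean p (fun a => ∑ i ∈ s, f i a) = ∑ i ∈ s, mean p (f i) := by
  simp only [mean, Finset.mul_sum]
  exact Finset.sum_comm

/-- Points of probability zero are exempt, so logarithms of likelihood ratios need be controlled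
only where they are genuine. -/
lemma mean_mono (p : PMF α) {f g : α → ℝ} (h : ∀ a, p a ≠ 0 → f a ≤ g a) :
    mean p f ≤ mean p g := by
  refine Finset.sum_le_sum fun a _ => ?_
  by_cases ha : p a = 0
  · simp [ha]
  · exact mul_le_mul_of_nonneg_left (h a ha) ENNReal.toReal_nonneg

lemma mean_congr (p : PMF α) {f g : α → ℝ} (h : ∀ a, p a ≠ 0 → f a = g a) :
    mean p f = mean p g :=
  le_antisymm (mean_mono p fun a ha => (h a ha).le) (mean_mono p fun a ha => (h a ha).ge)

lemma mean_nonneg (p : PMF α) {f : α → ℝ} (h : ∀ a, 0 ≤ f a) : 0 ≤ mean p f :=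
  Finset.sum_nonneg fun a _ => mul_nonneg ENNReal.toReal_nonneg (h a)

lemma mean_comm (p : PMF α) (q : PMF β) (f : α → β → ℝ) :
    mean p (fun a => mean q (f a)) = mean q (fun b => mean p (fun a => f a b)) := by
  simp only [mean, Finset.mul_sum]
  rw [Finset.sum_comm]
  exact Finset.sum_congr rfl fun b _ => Finset.sum_congr rfl fun a _ => by ring

open scoped Classical in
lemma mean_single (p : PMF α) (a : α) : mean p (fun b => if b = a then 1 else 0) = (p a).toReal := by
  simp [mean]

lemma mean_bind (p : PMF α) (k : α → PMF β) (f : β → ℝ) :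
    mean (p.bind k) f = mean p (fun a => mean (k a) f) := by
  simp only [mean, bind_toReal, Finset.sum_mul, Finset.mul_sum]
  rw [Finset.sum_comm]
  exact Finset.sum_congr rfl fun b _ => Finset.sum_congr rfl fun a _ => by ring

lemma mean_pure (a : α) (f : α → ℝ) : mean (PMF.pure a) f = f a := by
  classical
  simp [mean, PMF.pure_apply, apply_ite ENNReal.toReal]

lemma mean_map (p : PMF α) (g : α → β) (f : β → ℝ) :
    mean (p.map g) f = mean p (fun a => f (g a)) := by
  rw [PMF.map, mean_bind]
  simp [mean_pure]

lemma mean_uniform [Nonempty α] (f : α → ℝ) :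
    mean (PMF.uniformOfFintype α) f = (Fintype.card α : ℝ)⁻¹ * ∑ a, f a := by
  simp [mean, PMF.uniformOfFintype_apply, Finset.mul_sum]

open scoped Classical in
lemma toOuterMeasure_toReal (p : PMF α) (s : Set α) :
    (p.toOuterMeasure s).toReal = mean p (fun a => if a ∈ s then 1 else 0) := by
  rw [PMF.toOuterMeasure_apply_fintype, ENNReal.toReal_sum]
  · refine Finset.sum_congr rfl fun a _ => ?_
    by_cases h : a ∈ s <;> simp [h]
  · intro a _
    by_cases h : a ∈ s <;> simp [h, p.apply_ne_top a]

end Mean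

/-! ### Product distributions -/

section Product

variable {Y : Type*} [Fintype Y] {n : ℕ}

lemma prodPMF_toReal (p : Fin n → PMF Y) (y : Fin n → Y) :
    (prodPMF p y).toReal = ∏ i, (p i (y i)).toReal := by
  simp [prodPMF, PMF.ofFintype_apply]

lemma mean_prodPMF_prod (p : Fin n → PMF Y) (f : Fin n → Y → ℝ) :
    mean (prodPMF p) (fun y => ∏ i, f i (y i)) = ∏ i, mean (p i) (f i) := by
  classical
  simp only [mean, prodPMF_toReal, ← Finset.prod_mul_distrib]
  exact (Fintype.prod_sum fun i y => (p i y).toReal * f i y).symm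

lemma mean_prodPMF_apply (p : Fin n → PMF Y) (i : Fin n) (f : Y → ℝ) :
    mean (prodPMF p) (fun y => f (y i)) = mean (p i) f := by
  classical
  have h := mean_prodPMF_prod p (fun j y => if j = i then f y else 1)
  rw [Finset.prod_eq_single i (fun j _ hj => by simp [hj]) (by simp)] at h
  simpa using h

lemma mean_prodPMF_apply_mul (p : Fin n → PMF Y) {i j : Fin n} (hij : i ≠ j) (f g : Y → ℝ) :
    mean (prodPMF p) (fun y => f (y i) * g (y j)) = mean (p i) f * mean (p j) g := by
  classical
  have h := mean_prodPMF_prod p (fun k y => if k = i then f y else if k = j then g y else 1)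
  have key : ∀ F : Fin n → ℝ, (∀ k, k ≠ i → k ≠ j → F k = 1) → ∏ k, F k = F i * F j := by
    intro F hF
    refine Finset.prod_eq_mul i j hij (fun k _ hk => hF k hk.1 hk.2) (by simp) (by simp)
  rw [key _ (fun k h1 h2 => by simp [h1, h2])] at h
  rw [show (fun y : Fin n → Y => f (y i) * g (y j)) = fun y =>
    ∏ k, (if k = i then f (y k) else if k = j then g (y k) else 1) from
    funext fun y => by rw [key _ (fun k h1 h2 => by simp [h1, h2])]; simp [hij.symm], h]
  simp [hij.symm]

lemma prodPMF_bind_memoryless {X : Type*} [Fintype X] (p : Fin n → PMF X) (W : X → PMF Y) :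
    (prodPMF p).bind (memoryless W) = prodPMF fun i => (p i).bind W := by
  classical
  refine pmf_ext_toReal fun y => ?_
  rw [bind_toReal, prodPMF_toReal]
  simp only [memoryless, prodPMF_toReal, bind_toReal, ← Finset.prod_mul_distrib]
  exact (Fintype.prod_sum fun i x => (p i x).toReal * (W x (y i)).toReal).symm

end Product

/-! ### Relative entropy on finite alphabets -/

section RelEntropy

variable {α : Type*} [Fintype α]

/-- Full support of `q` leaves the empty set as the only null set. Absolute continuity is then
automatic, and the almost-everywhere value of the density holds at every point. -/
lemma relEntropy_eq (p q : PMF α) (hq : ∀ a, q a ≠ 0) :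
    relEntropy p q = ENNReal.ofReal (mean p fun a => Real.log ((p a).toReal / (q a).toReal)) := by
  let _ : MeasurableSpace α := ⊤
  have : MeasurableSingletonClass α := ⟨fun _ => trivial⟩
  have hsing : ∀ (r : PMF α) a, r.toMeasure {a} = r a :=
    fun r a => r.toMeasure_apply_singleton a (MeasurableSet.singleton a)
  have hac : p.toMeasure ≪ q.toMeasure := by
    intro s hs
    have : s = ∅ := by
      by_contra h
      obtain ⟨a, ha⟩ := Set.nonempty_iff_ne_empty.2 h
      have := MeasureTheory.measure_mono_null (Set.singleton_subset_iff.2 ha) hs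
      exact hq a (by rwa [hsing] at this)
    simp [this]
  have hmeas : Measurable fun a => p a / q a := measurable_from_top
  have hd : q.toMeasure.withDensity (fun a => p a / q a) = p.toMeasure := by
    refine MeasureTheory.Measure.ext_of_singleton fun a => ?_
    rw [MeasureTheory.withDensity_apply _ (MeasurableSet.singleton a),
      MeasureTheory.lintegral_singleton, hsing, hsing,
      ENNReal.div_mul_cancel (hq a) (q.apply_ne_top a)]
  have hae : ∀ᵐ x ∂q.toMeasure, p.toMeasure.rnDeriv q.toMeasure x = p x / q x := by
    have h := MeasureTheory.Measure.rnDeriv_withDensity q.toMeasure hmeas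
    rwa [hd] at h
  have hrn : ∀ a, p.toMeasure.rnDeriv q.toMeasure a = p a / q a := by
    intro a
    by_contra h
    have h2 := MeasureTheory.ae_iff.1 hae
    have := MeasureTheory.measure_mono_null (Set.singleton_subset_iff.2 h) h2
    exact hq a (by rwa [hsing] at this)
  have hint : MeasureTheory.Integrable (MeasureTheory.llr p.toMeasure q.toMeasure) p.toMeasure :=
    MeasureTheory.Integrable.of_finite
  change InformationTheory.klDiv p.toMeasure q.toMeasure = _
  rw [InformationTheory.klDiv_of_ac_of_integrable hac hint, PMF.integral_eq_sum]
  simp [mean, MeasureTheory.llr, hrn, ENNReal.toReal_div]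

/-- The variational bound behind Gibbs' inequality. -/
lemma mean_le_mean_log_add (p q : PMF α) (hq : ∀ a, q a ≠ 0) (f : α → ℝ) :
    mean p f ≤ mean p (fun a => Real.log ((p a).toReal / (q a).toReal)) +
      mean q (fun a => Real.exp (f a)) - 1 := by
  rw [← sum_toReal p]
  simp only [mean]
  rw [← Finset.sum_add_distrib, ← Finset.sum_sub_distrib]
  refine Finset.sum_le_sum fun a _ => ?_
  have hq' : 0 < (q a).toReal := ENNReal.toReal_pos (hq a) (q.apply_ne_top a)
  rcases (ENNReal.toReal_nonneg (a := p a)).eq_or_lt with h | h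
  · rw [← h]; simp; positivity
  · have hr : 0 < (p a).toReal / (q a).toReal := by positivity
    -- The whole inequality is `t + 1 ≤ exp t` at `t = f - log (p / q)`, averaged against `p`.
    have := Real.add_one_le_exp (f a - Real.log ((p a).toReal / (q a).toReal))
    rw [Real.exp_sub, Real.exp_log hr] at this
    have h2 := mul_le_mul_of_nonneg_left this h.le
    have h3 : (p a).toReal * (Real.exp (f a) / ((p a).toReal / (q a).toReal)) =
      (q a).toReal * Real.exp (f a) := by field_simp
    rw [h3] at h2
    linarith

lemma mean_log_nonneg (p q : PMF α) (hq : ∀ a, q a ≠ 0) :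
    0 ≤ mean p (fun a => Real.log ((p a).toReal / (q a).toReal)) := by
  have := mean_le_mean_log_add p q hq (fun _ => 0)
  simp at this
  exact this

lemma relEntropy_toReal (p q : PMF α) (hq : ∀ a, q a ≠ 0) :
    (relEntropy p q).toReal = mean p fun a => Real.log ((p a).toReal / (q a).toReal) := by
  rw [relEntropy_eq p q hq, ENNReal.toReal_ofReal (mean_log_nonneg p q hq)]

lemma mean_le_relEntropy_add (p q : PMF α) (hq : ∀ a, q a ≠ 0) (f : α → ℝ) :
    mean p f ≤ (relEntropy p q).toReal + mean q (fun a => Real.exp (f a)) - 1 := by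
  rw [relEntropy_toReal p q hq]
  exact mean_le_mean_log_add p q hq f

lemma relEntropy_ne_top (p q : PMF α) (hq : ∀ a, q a ≠ 0) : relEntropy p q ≠ ∞ := by
  rw [relEntropy_eq p q hq]; exact ENNReal.ofReal_ne_top

lemma relEntropy_toReal_pos {p q : PMF α} (hq : ∀ a, q a ≠ 0) (h : p ≠ q) :
    0 < (relEntropy p q).toReal := by
  refine ENNReal.toReal_pos (fun h0 => h ?_) (relEntropy_ne_top p q hq)
  let _ : MeasurableSpace α := ⊤
  have : MeasurableSingletonClass α := ⟨fun _ => trivial⟩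
  exact PMF.toMeasure_inj.1 (InformationTheory.klDiv_eq_zero_iff.1 h0)

lemma relEntropy_prodPMF {n : ℕ} (p q : Fin n → PMF α) (hq : ∀ i a, q i a ≠ 0) :
    (relEntropy (prodPMF p) (prodPMF q)).toReal = ∑ i, (relEntropy (p i) (q i)).toReal := by
  have hq' : ∀ a, prodPMF q a ≠ 0 := fun a => by
    simpa [prodPMF, PMF.ofFintype_apply, Finset.prod_eq_zero_iff] using fun i => hq i (a i)
  rw [relEntropy_toReal _ _ hq', mean_congr (g := fun y =>
    ∑ i, Real.log ((p i (y i)).toReal / (q i (y i)).toReal)), mean_sum]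
  · exact Finset.sum_congr rfl fun i _ => by
      rw [relEntropy_toReal _ _ (hq i)]
      exact mean_prodPMF_apply p i fun y => Real.log ((p i y).toReal / (q i y).toReal)
  · intro y hy
    rw [prodPMF_toReal, prodPMF_toReal, ← Finset.prod_div_distrib, Real.log_prod]
    intro i _
    have hi : p i (y i) ≠ 0 := by
      simp only [prodPMF, PMF.ofFintype_apply, ne_eq, Finset.prod_eq_zero_iff] at hy
      exact fun h => hy ⟨i, Finset.mem_univ _, h⟩
    exact (div_pos (ENNReal.toReal_pos hi ((p i).apply_ne_top _))
      (ENNReal.toReal_pos (hq i _) ((q i).apply_ne_top _))).ne'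

end RelEntropy

/-! ### The optimisation problem -/

section Optimum

variable {X Y : Type*} [Fintype X] [Fintype Y] (W : X → PMF Y) (x₀ : X)

/-- The relative entropy of the output distribution of `x` to that of the off symbol. -/
def gain (x : X) : ℝ := (relEntropy (W x) (W x₀)).toReal

/-- The change of the output distribution caused by the input weights `ν`. -/
def shift (ν : X → ℝ) (y : Y) : ℝ := ∑ x, ν x * ((W x y).toReal - (W x₀ y).toReal)

/-- Half the `χ²`-size of the shift of the output distribution. -/
def cost (ν : X → ℝ) : ℝ := 1 / 2 * ∑ y, shift W x₀ ν y ^ 2 / (W x₀ y).toReal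

variable {W x₀}

lemma shift_smul (c : ℝ) (ν : X → ℝ) (y : Y) :
    shift W x₀ (fun x => c * ν x) y = c * shift W x₀ ν y := by
  simp [shift, Finset.mul_sum, mul_assoc]

lemma cost_smul (c : ℝ) (ν : X → ℝ) : cost W x₀ (fun x => c * ν x) = c ^ 2 * cost W x₀ ν := by
  simp only [cost, shift_smul, mul_pow, mul_div_assoc, ← Finset.mul_sum]
  ring

lemma cost_nonneg (ν : X → ℝ) : 0 ≤ cost W x₀ ν := by
  unfold cost; positivity

lemma bind_sub_eq_shift (P : PMF X) (y : Y) :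
    (P.bind W y).toReal - (W x₀ y).toReal = shift W x₀ (fun x => (P x).toReal) y := by
  rw [bind_toReal]
  simp [shift, mul_sub, Finset.sum_sub_distrib, ← Finset.sum_mul, sum_toReal]

lemma ratio_eq (P : PMF X) : ratio W x₀ P =
    (∑ x, (P x).toReal * gain W x₀ x) / √(cost W x₀ fun x => (P x).toReal) := by
  simp only [ratio, gain, cost, bind_sub_eq_shift]

lemma toReal_off_pos (hq : ∀ y, W x₀ y ≠ 0) (y : Y) : 0 < (W x₀ y).toReal :=
  ENNReal.toReal_pos (hq y) ((W x₀).apply_ne_top y)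

lemma gain_off (hq : ∀ y, W x₀ y ≠ 0) : gain W x₀ x₀ = 0 := by
  rw [gain, relEntropy_toReal _ _ hq, mean_congr (g := fun _ => 0)]
  · simp
  · intro y hy
    rw [div_self (toReal_off_pos hq y).ne', Real.log_one]

lemma gain_nonneg (x : X) : 0 ≤ gain W x₀ x := ENNReal.toReal_nonneg

lemma gain_pos (hq : ∀ y, W x₀ y ≠ 0) (hred : ¬ Redundant W x₀) {x : X} (hx : x ≠ x₀) :
    0 < gain W x₀ x := by
  refine relEntropy_toReal_pos hq fun h => hred (subset_convexHull ℝ _ ⟨x, hx, ?_⟩)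
  rw [h]

/-- The weight at `x₀` does not enter the shift. Normalising the remaining weights turns a vanishing
shift into a convex representation of `Q₀`. -/
lemma redundant_of_shift_eq_zero {ν : X → ℝ} (h0 : ∀ x, 0 ≤ ν x) {x₁ : X} (h1 : x₁ ≠ x₀)
    (hν : ν x₁ ≠ 0) (hs : ∀ y, shift W x₀ ν y = 0) : Redundant W x₀ := by
  classical
  set s := Finset.univ.erase x₀
  have ha : 0 < ∑ x ∈ s, ν x :=
    Finset.sum_pos' (fun x _ => h0 x) ⟨x₁, by simp [s, h1], (h0 x₁).lt_of_ne' hν⟩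
  have key : (fun y => (W x₀ y).toReal) = s.centerMass ν fun x y => (W x y).toReal := by
    ext y
    have h := hs y
    rw [shift, ← Finset.add_sum_erase _ _ (Finset.mem_univ x₀), sub_self, mul_zero, zero_add] at h
    simp only [mul_sub, Finset.sum_sub_distrib, ← Finset.sum_mul] at h
    simp only [Finset.centerMass, Pi.smul_apply, Finset.sum_apply, smul_eq_mul]
    rw [eq_inv_mul_iff_mul_eq₀ ha.ne']
    linarith
  rw [Redundant, key]
  refine Finset.centerMass_mem_convexHull s (fun x _ => h0 x) ha fun x hx => ⟨x, ?_, rfl⟩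
  exact (Finset.mem_erase.1 hx).1

lemma cost_pos (hq : ∀ y, W x₀ y ≠ 0) (hred : ¬ Redundant W x₀) {ν : X → ℝ} (h0 : ∀ x, 0 ≤ ν x)
    {x₁ : X} (h1 : x₁ ≠ x₀) (hν : ν x₁ ≠ 0) : 0 < cost W x₀ ν := by
  refine (cost_nonneg ν).lt_of_ne' fun h => hred (redundant_of_shift_eq_zero h0 h1 hν fun y => ?_)
  have hn : ∀ y ∈ Finset.univ, 0 ≤ shift W x₀ ν y ^ 2 / (W x₀ y).toReal := fun y _ => by positivity
  have h2 : ∑ y, shift W x₀ ν y ^ 2 / (W x₀ y).toReal = 0 := by unfold cost at h; linarith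
  have h3 := (Finset.sum_eq_zero_iff_of_nonneg hn).1 h2 y (Finset.mem_univ y)
  rcases div_eq_zero_iff.1 h3 with h4 | h4
  · exact pow_eq_zero_iff two_ne_zero |>.1 h4
  · exact absurd h4 (toReal_off_pos hq y).ne'

lemma continuous_cost : Continuous (cost W x₀) := by
  unfold cost shift
  fun_prop

lemma exists_pmf_toReal {ν : X → ℝ} (h : ν ∈ stdSimplex ℝ X) :
    ∃ P : PMF X, ∀ x, (P x).toReal = ν x := by
  refine ⟨PMF.ofFintype (fun x => ENNReal.ofReal (ν x)) ?_, fun x => ?_⟩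
  · rw [← ENNReal.ofReal_sum_of_nonneg fun x _ => h.1 x, h.2, ENNReal.ofReal_one]
  · rw [PMF.ofFintype_apply, ENNReal.toReal_ofReal (h.1 x)]

/-- The optimum is attained. -/
lemma exists_isGreatest_ratio (hq : ∀ y, W x₀ y ≠ 0) (hred : ¬ Redundant W x₀)
    (hother : ∃ x : X, x ≠ x₀) :
    ∃ P : PMF X, P x₀ = 0 ∧ 0 < ratio W x₀ P ∧
      ∀ P' : PMF X, P' x₀ = 0 → ratio W x₀ P' ≤ ratio W x₀ P := by
  classical
  obtain ⟨x₁, h1⟩ := hother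
  have hex : ∀ ν ∈ stdSimplex ℝ X, ν x₀ = 0 → ∃ x, x ≠ x₀ ∧ ν x ≠ 0 := by
    intro ν hν h0
    by_contra! h
    have : ∑ x, ν x = 0 := Finset.sum_eq_zero fun x _ => by
      by_cases hx : x = x₀
      · rw [hx, h0]
      · exact h x hx
    linarith [hν.2]
  have hcp : ∀ ν ∈ stdSimplex ℝ X, ν x₀ = 0 → 0 < cost W x₀ ν := by
    intro ν hν h0
    obtain ⟨x, hx, hx'⟩ := hex ν hν h0
    exact cost_pos hq hred hν.1 hx hx'
  set K : Set (X → ℝ) := stdSimplex ℝ X ∩ {ν | ν x₀ = 0}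
  have hK : IsCompact K :=
    (isCompact_stdSimplex ℝ X).inter_right (isClosed_eq (continuous_apply x₀) continuous_const)
  have hne : K.Nonempty := ⟨Pi.single x₁ 1, single_mem_stdSimplex ℝ x₁, by simp [h1.symm]⟩
  have hcont : ContinuousOn (fun ν : X → ℝ => (∑ x, ν x * gain W x₀ x) / √(cost W x₀ ν)) K := by
    refine ContinuousOn.div (by fun_prop) continuous_cost.sqrt.continuousOn fun ν hν => ?_
    exact (Real.sqrt_pos.2 (hcp ν hν.1 hν.2)).ne'
  obtain ⟨ν, hν, hmax⟩ := hK.exists_isMaxOn hne hcont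
  obtain ⟨P, hP⟩ := exists_pmf_toReal hν.1
  have hP' : (fun x => (P x).toReal) = ν := funext hP
  refine ⟨P, ?_, ?_, fun P' h0 => ?_⟩
  · have := hP x₀
    rw [hν.2, ENNReal.toReal_eq_zero_iff] at this
    exact this.resolve_right (P.apply_ne_top x₀)
  · rw [ratio_eq, hP']
    simp only [hP]
    refine div_pos ?_ (Real.sqrt_pos.2 (hcp ν hν.1 hν.2))
    obtain ⟨x, hx, hx'⟩ := hex ν hν.1 hν.2
    exact Finset.sum_pos' (fun x _ => mul_nonneg (hν.1.1 x) (gain_nonneg x))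
      ⟨x, Finset.mem_univ x, mul_pos ((hν.1.1 x).lt_of_ne' hx') (gain_pos hq hred hx)⟩
  · rw [ratio_eq, ratio_eq, hP']
    simp only [hP]
    exact hmax (show (fun x => (P' x).toReal) ∈ K from
      ⟨⟨fun x => ENNReal.toReal_nonneg, sum_toReal P'⟩, by simp [h0]⟩)

/-- The bound on the ratio, in homogeneous form. -/
lemma sum_gain_le (hq : ∀ y, W x₀ y ≠ 0) (hred : ¬ Redundant W x₀) {L : ℝ}
    (hL : ∀ P : PMF X, P x₀ = 0 → ratio W x₀ P ≤ L) {ν : X → ℝ} (h0 : ∀ x, 0 ≤ ν x) :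
    ∑ x, ν x * gain W x₀ x ≤ L * √(cost W x₀ ν) := by
  classical
  -- Weight on `x₀` changes neither side, since both the shift and the gain vanish there. Removing
  -- it lets the rest be normalised to a competitor `P`.
  set μ : X → ℝ := fun x => if x = x₀ then 0 else ν x
  have hμ0 : ∀ x, 0 ≤ μ x := fun x => by simp only [μ]; split_ifs; exacts [le_rfl, h0 x]
  have hs : ∀ y, shift W x₀ ν y = shift W x₀ μ y := fun y =>
    Finset.sum_congr rfl fun x _ => by by_cases hx : x = x₀ <;> simp [μ, hx]
  have hc : cost W x₀ ν = cost W x₀ μ := by simp only [cost, hs]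
  have hg : ∑ x, ν x * gain W x₀ x = ∑ x, μ x * gain W x₀ x :=
    Finset.sum_congr rfl fun x _ => by by_cases hx : x = x₀ <;> simp [μ, hx, gain_off hq]
  rw [hc, hg]
  rcases (Finset.sum_nonneg fun x _ => hμ0 x : 0 ≤ ∑ x, μ x).eq_or_lt with h | h
  · have hz : ∀ x, μ x = 0 := fun x =>
      (Finset.sum_eq_zero_iff_of_nonneg fun x _ => hμ0 x).1 h.symm x (Finset.mem_univ x)
    simp [hz, cost, shift]
  set a := ∑ x, μ x
  have hmem : (fun x => a⁻¹ * μ x) ∈ stdSimplex ℝ X :=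
    ⟨fun x => mul_nonneg (inv_nonneg.2 h.le) (hμ0 x), by
      rw [← Finset.mul_sum]; exact inv_mul_cancel₀ h.ne'⟩
  obtain ⟨P, hP⟩ := exists_pmf_toReal hmem
  have hP0 : P x₀ = 0 := by
    have := hP x₀
    simp only [μ, if_true, mul_zero, ENNReal.toReal_eq_zero_iff] at this
    exact this.resolve_right (P.apply_ne_top x₀)
  have hr := hL P hP0
  have hP' : (fun x => (P x).toReal) = fun x => a⁻¹ * μ x := funext hP
  rw [ratio_eq, hP', cost_smul, Real.sqrt_mul (sq_nonneg _), Real.sqrt_sq (inv_nonneg.2 h.le)] at hr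
  simp only [hP, mul_assoc, ← Finset.mul_sum] at hr
  rw [mul_div_mul_left _ _ (inv_ne_zero h.ne')] at hr
  obtain ⟨x₁, -, hx₁⟩ := Finset.exists_ne_zero_of_sum_ne_zero h.ne'
  have hx₁' : x₁ ≠ x₀ := fun hx => hx₁ (by simp [μ, hx])
  exact (div_le_iff₀ (Real.sqrt_pos.2 (cost_pos hq hred hμ0 hx₁' hx₁))).1 hr

/-- Each entry of `W(·|x) - Q₀` is at most `1` in absolute value, and every symbol but `x₀` has
positive gain. The shift is thus dominated by the total gain, hence by the root of the cost. This
uniform smallness controls the Taylor remainders in both halves of the proof. -/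
lemma exists_abs_shift_div_le (hq : ∀ y, W x₀ y ≠ 0) (hred : ¬ Redundant W x₀) {L : ℝ}
    (hL : ∀ P : PMF X, P x₀ = 0 → ratio W x₀ P ≤ L) :
    ∃ G : ℝ, 0 ≤ G ∧ ∀ ν : X → ℝ, (∀ x, 0 ≤ ν x) → ∀ y,
      |shift W x₀ ν y| / (W x₀ y).toReal ≤ G * √(cost W x₀ ν) := by
  classical
  -- The summand at `x₀` is `0⁻¹ = 0` and does no harm.
  set Γ : ℝ := ∑ x, (gain W x₀ x)⁻¹
  set R : ℝ := ∑ y, ((W x₀ y).toReal)⁻¹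
  have hΓ : ∀ x, (gain W x₀ x)⁻¹ ≤ Γ := fun x =>
    Finset.single_le_sum (f := fun x => (gain W x₀ x)⁻¹)
      (fun x _ => inv_nonneg.2 (gain_nonneg x)) (Finset.mem_univ x)
  have hΓ0 : 0 ≤ Γ := Finset.sum_nonneg fun x _ => inv_nonneg.2 (gain_nonneg x)
  have hR : ∀ y, ((W x₀ y).toReal)⁻¹ ≤ R := fun y =>
    Finset.single_le_sum (f := fun y => ((W x₀ y).toReal)⁻¹)
      (fun y _ => inv_nonneg.2 ENNReal.toReal_nonneg) (Finset.mem_univ y)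
  have hR0 : 0 ≤ R := Finset.sum_nonneg fun y _ => inv_nonneg.2 ENNReal.toReal_nonneg
  have hgen : ∀ ν : X → ℝ, (∀ x, 0 ≤ ν x) → ∀ y,
      |shift W x₀ ν y| / (W x₀ y).toReal ≤ Γ * (L * √(cost W x₀ ν)) * R := by
    intro ν h0 y
    rw [div_eq_mul_inv]
    refine mul_le_mul ?_ (hR y) (inv_nonneg.2 ENNReal.toReal_nonneg)
      ((abs_nonneg (shift W x₀ ν y)).trans ?_)
    all_goals
      calc |shift W x₀ ν y| ≤ ∑ x, |ν x * ((W x y).toReal - (W x₀ y).toReal)| :=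
            Finset.abs_sum_le_sum_abs _ _
        _ ≤ ∑ x, Γ * (ν x * gain W x₀ x) := by
            refine Finset.sum_le_sum fun x _ => ?_
            by_cases hx : x = x₀
            · simp [hx, gain_off hq]
            rw [abs_mul, abs_of_nonneg (h0 x)]
            have h1 : |(W x y).toReal - (W x₀ y).toReal| ≤ 1 := by
              rw [abs_le]
              constructor <;> linarith [toReal_le_one (W x) y, toReal_le_one (W x₀) y,
                ENNReal.toReal_nonneg (a := W x y), ENNReal.toReal_nonneg (a := W x₀ y)]
            have hp := gain_pos hq hred hx
            have h2 : 1 ≤ Γ * gain W x₀ x := by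
              have := mul_le_mul_of_nonneg_right (hΓ x) hp.le
              rwa [inv_mul_cancel₀ hp.ne'] at this
            calc ν x * |(W x y).toReal - (W x₀ y).toReal| ≤ ν x * (Γ * gain W x₀ x) :=
                  mul_le_mul_of_nonneg_left (h1.trans h2) (h0 x)
              _ = _ := by ring
        _ = Γ * ∑ x, ν x * gain W x₀ x := by rw [Finset.mul_sum]
        _ ≤ Γ * (L * √(cost W x₀ ν)) :=
            mul_le_mul_of_nonneg_left (sum_gain_le hq hred hL h0) hΓ0
  -- The absolute value is taken because `L` is not assumed nonnegative here.
  refine ⟨|Γ * L * R|, abs_nonneg _, fun ν h0 y => (hgen ν h0 y).trans ?_⟩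
  calc Γ * (L * √(cost W x₀ ν)) * R = (Γ * L * R) * √(cost W x₀ ν) := by ring
    _ ≤ _ := mul_le_mul_of_nonneg_right (le_abs_self _) (Real.sqrt_nonneg _)

end Optimum

/-! ### Laws induced by a random code -/

section Codes

variable {X Y M : Type*} [Fintype X] [Fintype Y] [Fintype M] [Nonempty M] {n : ℕ}

/-- The distribution on input sequences induced by a random code. -/
def inputLaw (C : PMF (Code X Y M n)) : PMF (Fin n → X) :=
  C.bind fun c => (PMF.uniformOfFintype M).map c.1

lemma outputLaw_eq (W : X → PMF Y) (C : PMF (Code X Y M n)) :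
    outputLaw W C = (inputLaw C).bind (memoryless W) := by
  simp only [outputLaw, jointLaw, inputLaw, PMF.map_bind, PMF.bind_bind, PMF.bind_map,
    PMF.map_comp]
  congr 1
  ext1 c
  congr 1
  ext1 m
  exact PMF.map_id _

lemma errorProb_toReal [DecidableEq M] [Fintype (Code X Y M n)] (W : X → PMF Y)
    (C : PMF (Code X Y M n)) :
    (errorProb W C).toReal = mean C fun c => mean (PMF.uniformOfFintype M) fun m =>
      mean (memoryless W (c.1 m)) fun y => if c.2 y = m then 0 else 1 := by
  classical
  rw [errorProb, toOuterMeasure_toReal, jointLaw, mean_bind]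
  simp only [mean_bind, mean_map, Set.mem_ofPred_eq, ne_eq]
  refine congrArg _ (funext fun c => congrArg _ (funext fun m => congrArg _ (funext fun y => ?_)))
  by_cases h : c.2 y = m <;> simp [h]

end Codes

/-! ### Converse -/

section Converse

variable {X Y : Type*} [Fintype X] [Fintype Y] {W : X → PMF Y} {x₀ : X} {n : ℕ}

lemma prodPMF_ne_zero {q : Fin n → PMF Y} (hq : ∀ i y, q i y ≠ 0) (y : Fin n → Y) :
    prodPMF q y ≠ 0 := by
  simpa [prodPMF, PMF.ofFintype_apply, Finset.prod_eq_zero_iff] using fun i => hq i (y i)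

/-- A code, even with common randomness, transmits at most as many nats as the relative entropy
to the off output that its codewords produce. -/
lemma mul_log_card_le {M : Type*} [Fintype M] [Nonempty M] (hq : ∀ y, W x₀ y ≠ 0)
    (C : PMF (Code X Y M n)) :
    (1 - (errorProb W C).toReal) * Real.log (Fintype.card M) ≤
      mean (inputLaw C) (fun x => ∑ i, gain W x₀ (x i)) + 1 := by
  classical
  set K : ℝ := ((Fintype.card M : ℕ) : ℝ) with hKdef
  have hK : 0 < K := Nat.cast_pos.2 Fintype.card_pos
  set Q : PMF (Fin n → Y) := prodPMF fun _ => W x₀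
  have hcode : ∀ (c : Code X Y M n) (m : M),
      (1 - mean (memoryless W (c.1 m)) fun y => if c.2 y = m then 0 else 1) * Real.log K ≤
        ∑ i, gain W x₀ (c.1 m i) + (K - 1) * mean Q (fun y => if c.2 y = m then 1 else 0) := by
    intro c m
    -- The test function is `log K` on correct decoding and `0` elsewhere, so its exponential is
    -- affine in the indicator.
    have h := mean_le_relEntropy_add (memoryless W (c.1 m)) Q
      (prodPMF_ne_zero fun _ => hq) (fun y => (if c.2 y = m then 1 else 0) * Real.log K)
    have he : ∀ y, Real.exp ((if c.2 y = m then 1 else 0) * Real.log K) =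
        1 + (K - 1) * (if c.2 y = m then 1 else 0) := by
      intro y
      split_ifs <;> simp [Real.exp_log hK]
    simp only [he] at h
    rw [mean_add, mean_const, mean_mul_left, mean_mul_right, memoryless,
      relEntropy_prodPMF _ _ (fun _ => hq)] at h
    have h1 : (1 - mean (memoryless W (c.1 m)) fun y => if c.2 y = m then 0 else 1) =
        mean (memoryless W (c.1 m)) fun y => if c.2 y = m then 1 else 0 := by
      rw [← mean_const (memoryless W (c.1 m)) 1, ← mean_sub]
      congr 1
      ext y
      split_ifs <;> simp
    rw [h1, memoryless]
    simp only [gain]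
    linarith
  -- The decoding regions of the messages partition the output space. Their `Q`-probabilities sum to
  -- one, and the average over messages is `(K - 1) / K`.
  have hmsg : ∀ c : Code X Y M n,
      mean (PMF.uniformOfFintype M) (fun m => (K - 1) *
        mean Q (fun y => if c.2 y = m then 1 else 0)) ≤ 1 := by
    intro c
    rw [mean_mul_left, mean_uniform, ← mean_sum]
    simp only [Finset.sum_ite_eq, Finset.mem_univ, if_true, mean_const, mul_one]
    change (K - 1) * K⁻¹ ≤ 1
    rw [← div_eq_mul_inv, div_le_one hK]
    linarith
  have h1 : mean C (fun c => mean (PMF.uniformOfFintype M) fun m =>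
      (1 - mean (memoryless W (c.1 m)) fun y => if c.2 y = m then 0 else 1) * Real.log K) ≤
      mean C (fun c => mean (PMF.uniformOfFintype M) (fun m => ∑ i, gain W x₀ (c.1 m i)) + 1) := by
    refine mean_mono C fun c _ => ?_
    refine (mean_mono _ fun m _ => hcode c m).trans ?_
    rw [mean_add]
    exact add_le_add_right (hmsg c) _
  simp only [mean_mul_right, mean_sub, mean_const, mean_add] at h1
  rw [errorProb_toReal, inputLaw, mean_bind]
  simpa only [mean_map] using h1

open scoped Classical in
/-- The expected number of occurrences of a symbol in a random input sequence. -/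
def meanCount (P : PMF (Fin n → X)) (a : X) : ℝ :=
  mean P fun x => ∑ i, if x i = a then 1 else 0

lemma meanCount_nonneg (P : PMF (Fin n → X)) (a : X) : 0 ≤ meanCount P a :=
  mean_nonneg P fun x => Finset.sum_nonneg fun i _ => by split_ifs <;> simp

/-- Grouping positions by symbol shows that additive functions of the input depend on its law only
through the expected counts. -/
lemma mean_sum_apply (P : PMF (Fin n → X)) (f : X → ℝ) :
    mean P (fun x => ∑ i, f (x i)) = ∑ a, meanCount P a * f a := by
  classical
  simp only [meanCount, ← mean_mul_right, ← mean_sum]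
  congr 1
  ext x
  simp only [Finset.sum_mul]
  rw [Finset.sum_comm]
  simp

lemma sum_meanCount (P : PMF (Fin n → X)) : ∑ a, meanCount P a = n := by
  have := mean_sum_apply P fun _ => 1
  simpa using this.symm

lemma exp_le_cubic {u : ℝ} (hu : |u| ≤ 1) : Real.exp u ≤ 1 + u + u ^ 2 / 2 + |u| * u ^ 2 := by
  have h := (abs_le.1 (Real.exp_bound hu (n := 3) (by norm_num))).2
  simp only [Finset.sum_range_succ, Finset.sum_range_zero, Nat.factorial] at h
  norm_num at h
  have h3 : |u| ^ 3 = |u| * u ^ 2 := by rw [pow_succ', sq_abs]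
  rw [h3] at h
  nlinarith [mul_nonneg (abs_nonneg u) (sq_nonneg u)]

lemma sum_shift (ν : X → ℝ) : ∑ y, shift W x₀ ν y = 0 := by
  simp only [shift]
  rw [Finset.sum_comm]
  simp [← Finset.mul_sum, sum_toReal]

/-- The relative entropy at the output bounds the cost of the expected input counts. -/
lemma two_mul_sqrt_cost_le (hq : ∀ y, W x₀ y ≠ 0) {G : ℝ} (hG0 : 0 ≤ G)
    (hG : ∀ ν : X → ℝ, (∀ x, 0 ≤ ν x) → ∀ y,
      |shift W x₀ ν y| / (W x₀ y).toReal ≤ G * √(cost W x₀ ν))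
    (P : PMF (Fin n → X)) {s : ℝ} (hs : 0 ≤ s) (hsG : s * G ≤ 1) :
    2 * s * √(cost W x₀ (meanCount P)) ≤
      (relEntropy (P.bind (memoryless W)) (prodPMF fun _ => W x₀)).toReal +
        n * (s ^ 2 * (1 + 2 * (s * G))) := by
  classical
  set N := meanCount P
  set v := √(cost W x₀ N)
  set q : Y → ℝ := fun y => (W x₀ y).toReal
  have hq' : ∀ y, 0 < q y := toReal_off_pos hq
  have hv0 : 0 ≤ v := Real.sqrt_nonneg _
  have hv : ∑ y, shift W x₀ N y ^ 2 / q y = 2 * v ^ 2 := by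
    rw [Real.sq_sqrt (cost_nonneg N), cost]; ring
  -- This is the direction that pairs best with the shift in the `χ²`-geometry: mean zero under `Q₀`
  -- and second moment at most `2 s²`. If `v = 0`, division by zero makes `f` vanish and the
  -- argument still runs.
  set f : Y → ℝ := fun y => s * (shift W x₀ N y / (v * q y))
  -- The quantity `c` bounds `mean (W x₀) (exp f) - 1`: it is `(1/2 + s G)` from `exp_le_cubic`
  -- times the second moment `2 s²`. Subtracting it at each letter keeps the exponential moment of
  -- the sum below one.
  set c := s ^ 2 * (1 + 2 * (s * G))
  have hf : ∀ y, |f y| ≤ s * G := by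
    intro y
    simp only [f]
    rw [abs_mul, abs_of_nonneg hs]
    refine mul_le_mul_of_nonneg_left ?_ hs
    rcases hv0.eq_or_lt with h | h
    · rw [← h]; simpa using hG0
    · rw [abs_div, abs_of_pos (mul_pos h (hq' y)), mul_comm v, ← div_div, div_le_iff₀ h]
      exact hG N (meanCount_nonneg P) y
  have hf1 : mean (W x₀) f = 0 := by
    have : mean (W x₀) f = s / v * ∑ y, shift W x₀ N y := by
      rw [Finset.mul_sum]
      refine Finset.sum_congr rfl fun y _ => ?_
      have := (hq' y).ne'
      change q y * f y = _
      simp only [f]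
      rcases eq_or_ne v 0 with h | h
      · simp [h]
      · field_simp
    rw [this, sum_shift, mul_zero]
  have hf2 : mean (W x₀) (fun y => f y ^ 2) ≤ 2 * s ^ 2 := by
    have : mean (W x₀) (fun y => f y ^ 2) = s ^ 2 / v ^ 2 * ∑ y, shift W x₀ N y ^ 2 / q y := by
      rw [Finset.mul_sum]
      refine Finset.sum_congr rfl fun y _ => ?_
      have := (hq' y).ne'
      change q y * f y ^ 2 = _
      simp only [f]
      rcases eq_or_ne v 0 with h | h
      · simp [h]
      · field_simp
    rw [this, hv]
    rcases eq_or_ne v 0 with h | h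
    · simp [h]; positivity
    · have : s ^ 2 / v ^ 2 * (2 * v ^ 2) = 2 * s ^ 2 := by field_simp
      exact this.le
  have hexp : mean (W x₀) (fun y => Real.exp (f y - c)) ≤ 1 := by
    have h1 : mean (W x₀) (fun y => Real.exp (f y)) ≤ 1 + c := by
      calc mean (W x₀) (fun y => Real.exp (f y))
          ≤ mean (W x₀) (fun y => 1 + f y + (1 / 2 + s * G) * f y ^ 2) := by
            refine mean_mono _ fun y _ => (exp_le_cubic ((hf y).trans hsG)).trans ?_
            nlinarith [mul_le_mul_of_nonneg_right (hf y) (sq_nonneg (f y))]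
        _ = 1 + (1 / 2 + s * G) * mean (W x₀) (fun y => f y ^ 2) := by
            rw [mean_add _ (fun y => 1 + f y), mean_add _ (fun _ => 1) f, mean_const,
              mean_mul_left _ _ (fun y => f y ^ 2), hf1, add_zero]
        _ ≤ 1 + (1 / 2 + s * G) * (2 * s ^ 2) := by
            have : 0 ≤ s * G := mul_nonneg hs hG0
            gcongr
        _ = 1 + c := by simp only [c]; ring
    simp only [sub_eq_add_neg, Real.exp_add]
    rw [mean_mul_right]
    calc _ ≤ (1 + c) * Real.exp (-c) := mul_le_mul_of_nonneg_right h1 (Real.exp_pos _).le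
      _ ≤ Real.exp c * Real.exp (-c) := by
          refine mul_le_mul_of_nonneg_right ?_ (Real.exp_pos _).le
          linarith [Real.add_one_le_exp c]
      _ = 1 := by rw [← Real.exp_add]; simp
  have hDV := mean_le_relEntropy_add (P.bind (memoryless W)) (prodPMF fun _ => W x₀)
    (prodPMF_ne_zero fun _ => hq) fun y => ∑ i, (f (y i) - c)
  have hE : mean (prodPMF fun _ : Fin n => W x₀) (fun y => Real.exp (∑ i, (f (y i) - c))) ≤ 1 := by
    simp only [Real.exp_sum]
    rw [mean_prodPMF_prod _ fun _ y => Real.exp (f y - c)]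
    exact Finset.prod_le_one (fun _ _ => mean_nonneg _ fun y => (Real.exp_pos _).le) fun _ _ => hexp
  have hl : mean (P.bind (memoryless W)) (fun y => ∑ i, (f (y i) - c)) = 2 * s * v - n * c := by
    rw [mean_bind]
    have h1 : ∀ x : Fin n → X, mean (memoryless W x) (fun y => ∑ i, (f (y i) - c)) =
        ∑ i, (mean (W (x i)) f - c) := by
      intro x
      rw [mean_sum]
      refine Finset.sum_congr rfl fun i _ => ?_
      rw [memoryless, mean_prodPMF_apply (fun i => W (x i)) i fun y => f y - c, mean_sub, mean_const]
    simp only [h1]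
    rw [mean_sum_apply P fun a => mean (W a) f - c]
    simp only [mul_sub, Finset.sum_sub_distrib, ← Finset.sum_mul, sum_meanCount]
    congr 1
    have h2 : ∑ a, N a * mean (W a) f = ∑ y, shift W x₀ N y * f y := by
      calc ∑ a, N a * mean (W a) f = ∑ a, N a * (mean (W a) f - mean (W x₀) f) := by
            simp [hf1]
        _ = ∑ a, ∑ y, N a * ((W a y).toReal - (W x₀ y).toReal) * f y := by
            refine Finset.sum_congr rfl fun a _ => ?_
            simp only [mean, ← Finset.sum_sub_distrib, Finset.mul_sum]
            exact Finset.sum_congr rfl fun y _ => by ring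
        _ = _ := by
            rw [Finset.sum_comm]
            simp only [shift, Finset.sum_mul]
    rw [h2]
    have h3 : ∑ y, shift W x₀ N y * f y = s / v * ∑ y, shift W x₀ N y ^ 2 / q y := by
      rw [Finset.mul_sum]
      refine Finset.sum_congr rfl fun y _ => ?_
      have := (hq' y).ne'
      simp only [f]
      rcases eq_or_ne v 0 with h | h
      · simp [h]
      · field_simp
    rw [h3, hv]
    rcases eq_or_ne v 0 with h | h
    · simp [h]
    · field_simp
  rw [hl] at hDV
  linarith

/-- The upper bound on the number of messages. -/
lemma log_card_le (hq : ∀ y, W x₀ y ≠ 0) (hred : ¬ Redundant W x₀) {L : ℝ} (hL0 : 0 ≤ L)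
    (hL : ∀ P : PMF X, P x₀ = 0 → ratio W x₀ P ≤ L) {δ : ℝ} (hδ : 0 < δ) :
    ∃ G : ℝ, 0 ≤ G ∧ ∀ (n M : ℕ) (ε : ℝ), 0 < n → 0 ≤ ε → ε < 1 → √(δ / n) * G ≤ 1 →
      Achievable W x₀ δ ε n M →
        Real.log M ≤ (L * (√(n * δ) * (1 + √(δ / n) * G)) + 1) / (1 - ε) := by
  obtain ⟨G, hG0, hG⟩ := exists_abs_shift_div_le hq hred hL
  refine ⟨G, hG0, fun n M ε hn hε hε1 hs hA => ?_⟩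
  obtain ⟨hM, C, hD, hE⟩ := hA
  -- This choice balances the two leading terms of the bound, as `n s² = δ`.
  set s := √(δ / n)
  have hn' : (0 : ℝ) < n := Nat.cast_pos.2 hn
  have hs0 : 0 < s := Real.sqrt_pos.2 (by positivity)
  have hs2 : n * s ^ 2 = δ := by
    rw [Real.sq_sqrt (by positivity)]; field_simp
  have hns : √(n * δ) = n * s := by
    rw [← hs2, show (n : ℝ) * (n * s ^ 2) = (n * s) ^ 2 by ring, Real.sqrt_sq (by positivity)]
  have hD' : (relEntropy ((inputLaw C).bind (memoryless W)) (prodPMF fun _ => W x₀)).toReal ≤ δ := by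
    rw [← outputLaw_eq]
    exact ENNReal.toReal_le_of_le_ofReal hδ.le hD
  have hE' : (errorProb W C).toReal ≤ ε := ENNReal.toReal_le_of_le_ofReal hε hE
  have h1 := two_mul_sqrt_cost_le hq hG0 hG (inputLaw C) hs0.le hs
  have h2 := sum_gain_le hq hred hL (meanCount_nonneg (inputLaw C))
  have h3 := mul_log_card_le hq C
  rw [mean_sum_apply, Fintype.card_fin] at h3
  have h4 : √(cost W x₀ (meanCount (inputLaw C))) ≤ n * s * (1 + s * G) := by
    have : 2 * s * √(cost W x₀ (meanCount (inputLaw C))) ≤ 2 * s * (n * s * (1 + s * G)) := by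
      calc _ ≤ δ + n * (s ^ 2 * (1 + 2 * (s * G))) := h1.trans (by gcongr)
        _ = _ := by rw [← hs2]; ring
    exact le_of_mul_le_mul_left this (by positivity)
  rw [le_div_iff₀ (by linarith), hns]
  have hlog : 0 ≤ Real.log M := Real.log_natCast_nonneg M
  calc Real.log M * (1 - ε) ≤ (1 - (errorProb W C).toReal) * Real.log M := by
        rw [mul_comm]; gcongr
    _ ≤ _ := h3
    _ ≤ L * √(cost W x₀ (meanCount (inputLaw C))) + 1 := by gcongr
    _ ≤ _ := by gcongr

end Converse

/-! ### Random coding with a threshold test -/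

section RandomCoding

variable {X Y M : Type*} [Fintype X] [Fintype Y] {n : ℕ}

lemma pmf_ext_mean {α : Type*} [Fintype α] {p q : PMF α} (h : ∀ f, mean p f = mean q f) :
    p = q := by
  classical
  exact pmf_ext_toReal fun a => by rw [← mean_single, ← mean_single, h]

open scoped Classical in
/-- A decoder that returns a message whose codeword passes the test `T` together with the output
sequence, if there is one. -/
def testDecoder [Nonempty M] (T : (Fin n → X) → (Fin n → Y) → Prop) (e : M → Fin n → X)
    (y : Fin n → Y) : M :=
  if h : ∃ m, T (e m) y then h.choose else Classical.arbitrary M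

open scoped Classical in
-- Union bound: when the true codeword passes the test, the decoder returns some passing message, so
-- an error exhibits a wrong codeword that passes.
lemma testDecoder_error_le [Nonempty M] [Fintype M] (T : (Fin n → X) → (Fin n → Y) → Prop)
    (e : M → Fin n → X) (y : Fin n → Y) (m : M) :
    (if testDecoder T e y = m then 0 else 1 : ℝ) ≤
      (if T (e m) y then 0 else 1) +
        ∑ m' ∈ Finset.univ.erase m, if T (e m') y then (1 : ℝ) else 0 := by
  have hnn : ∀ m' ∈ Finset.univ.erase m, (0 : ℝ) ≤ if T (e m') y then (1 : ℝ) else 0 :=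
    fun m' _ => by split_ifs <;> simp
  have hsum := Finset.sum_nonneg hnn
  by_cases hd : testDecoder T e y = m
  · rw [if_pos hd]
    split_ifs <;> linarith
  by_cases hT : T (e m) y
  · have hex : ∃ m, T (e m) y := ⟨m, hT⟩
    have hd' : testDecoder T e y = hex.choose := dif_pos hex
    have hT' : T (e (testDecoder T e y)) y := hd' ▸ hex.choose_spec
    have := Finset.single_le_sum hnn (Finset.mem_erase.2 ⟨hd, Finset.mem_univ _⟩)
    rw [if_pos hT'] at this
    rw [if_neg hd, if_pos hT]
    linarith
  · rw [if_neg hd, if_neg hT]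
    linarith

open scoped Classical in
/-- Random coding with independent codewords of law `P`. -/
lemma exists_randomCode (W : X → PMF Y) (P : PMF (Fin n → X))
    (T : (Fin n → X) → (Fin n → Y) → Prop) (N : ℕ) [NeZero N] :
    ∃ C : PMF (Code X Y (Fin N) n), outputLaw W C = P.bind (memoryless W) ∧
      (errorProb W C).toReal ≤
        mean P (fun x => mean (memoryless W x) fun y => if T x y then 0 else 1) +
        N * mean (P.bind (memoryless W)) fun y => mean P fun x => if T x y then 1 else 0 := by
  set B : PMF (Fin N → Fin n → X) := prodPMF fun _ => P
  set fa := mean (P.bind (memoryless W)) fun y => mean P fun x => if T x y then (1 : ℝ) else 0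
  set miss := mean P (fun x => mean (memoryless W x) fun y => if T x y then (0 : ℝ) else 1)
  refine ⟨B.map fun e => (e, testDecoder T e), ?_, ?_⟩
  · rw [outputLaw_eq]
    congr 1
    refine pmf_ext_mean fun f => ?_
    rw [inputLaw, mean_bind, mean_map]
    simp only [mean_map]
    rw [mean_comm]
    simp only [B, fun m => mean_prodPMF_apply (fun _ : Fin N => P) m f, mean_const]
  · have hfa0 : 0 ≤ fa := mean_nonneg _ fun y => mean_nonneg _ fun x => by split_ifs <;> simp
    rw [errorProb_toReal, mean_map, mean_comm]
    rw [← mean_const (PMF.uniformOfFintype (Fin N)) (miss + N * fa)]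
    refine mean_mono _ fun m _ => ?_
    -- Codewords of distinct messages are independent, so the output produced by `m` is independent
    -- of the codeword of `m'`.
    have hpair : ∀ m' ∈ Finset.univ.erase m,
        mean B (fun e => mean (memoryless W (e m)) fun y => if T (e m') y then (1 : ℝ) else 0) =
          fa := by
      intro m' hm'
      simp only [fa, mean_bind]
      have h1 : ∀ e : Fin N → Fin n → X,
          mean (memoryless W (e m)) (fun y => if T (e m') y then (1 : ℝ) else 0) =
            ∑ y, (memoryless W (e m) y).toReal * if T (e m') y then (1 : ℝ) else 0 := fun e => rfl
      simp only [h1]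
      rw [mean_sum]
      have h2 : ∀ y : Fin n → Y, mean B (fun e => (memoryless W (e m) y).toReal *
          if T (e m') y then (1 : ℝ) else 0) = mean P (fun x => (memoryless W x y).toReal) *
          mean P (fun x => if T x y then (1 : ℝ) else 0) := fun y =>
        mean_prodPMF_apply_mul (fun _ : Fin N => P) (Finset.ne_of_mem_erase hm').symm
          (fun x => (memoryless W x y).toReal) (fun x => if T x y then (1 : ℝ) else 0)
      simp only [h2, ← mean_mul_right]
      rw [← mean_sum]
      rfl
    calc _ ≤ mean B (fun e => mean (memoryless W (e m)) fun y => (if T (e m) y then 0 else 1) +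
          ∑ m' ∈ Finset.univ.erase m, if T (e m') y then (1 : ℝ) else 0) :=
          mean_mono _ fun e _ => mean_mono _ fun y _ => by
            convert testDecoder_error_le T e y m
      _ = miss + ∑ m' ∈ Finset.univ.erase m, fa := by
          simp only [mean_add, mean_sum]
          rw [Finset.sum_congr rfl hpair]
          congr 1
          exact mean_prodPMF_apply (fun _ : Fin N => P) m fun x =>
            mean (memoryless W x) fun y => if T x y then (0 : ℝ) else 1
      _ ≤ miss + N * fa := by
          rw [Finset.sum_const, nsmul_eq_mul]
          have hc : (Finset.univ.erase m).card ≤ N := by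
            simp
          gcongr

end RandomCoding

/-! ### Finite-blocklength achievability -/

section Achievability

variable {X Y : Type*} [Fintype X] [Fintype Y] {W : X → PMF Y} {x₀ : X} {n : ℕ}

open scoped Classical in
/-- The probability that an independent codeword passes the likelihood-ratio test. -/
lemma false_alarm_le (hq : ∀ y, W x₀ y ≠ 0) (P : PMF X) (γ : ℝ) :
    (mean ((prodPMF fun _ : Fin n => P).bind (memoryless W)) fun y =>
      mean (prodPMF fun _ : Fin n => P) fun x =>
        if Real.exp γ * (prodPMF (fun _ : Fin n => W x₀) y).toReal ≤ (memoryless W x y).toReal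
          then (1 : ℝ) else 0) ≤
      Real.exp (2 * (n * cost W x₀ fun x => (P x).toReal) - γ) := by
  set h := shift W x₀ fun x => (P x).toReal
  set κ := cost W x₀ fun x => (P x).toReal
  have hq' := toReal_off_pos hq
  have hQ0 : ∀ y, 0 < (prodPMF (fun _ : Fin n => W x₀) y).toReal := fun y => by
    rw [prodPMF_toReal]; exact Finset.prod_pos fun i _ => hq' _
  -- The mean of the output likelihood ratio is one plus the `χ²`-distance, which is `2 κ`.
  have h1 : mean (P.bind W) (fun y => (P.bind W y).toReal / (W x₀ y).toReal) = 1 + 2 * κ := by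
    have hy : ∀ y, (P.bind W y).toReal = (W x₀ y).toReal + h y := fun y => by
      have := bind_sub_eq_shift (W := W) (x₀ := x₀) P y
      linarith
    have : ∀ y, (P.bind W y).toReal * ((P.bind W y).toReal / (W x₀ y).toReal) =
        (W x₀ y).toReal + 2 * h y + h y ^ 2 / (W x₀ y).toReal := by
      intro y
      have := (hq' y).ne'
      rw [hy]; field_simp; ring
    simp only [mean, this, Finset.sum_add_distrib, sum_toReal, ← Finset.mul_sum]
    rw [sum_shift]
    simp only [κ, cost]
    ring
  -- Markov's inequality: a passing pair satisfies `1 ≤ exp (-γ) W(y|x) / Q₀(y)`. Averaging over the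
  -- independent codeword replaces `W(y|x)` by the output law.
  calc _ ≤ mean ((prodPMF fun _ : Fin n => P).bind (memoryless W)) (fun y =>
        mean (prodPMF fun _ : Fin n => P) fun x => (memoryless W x y).toReal *
          (Real.exp (-γ) / (prodPMF (fun _ : Fin n => W x₀) y).toReal)) := by
        refine mean_mono _ fun y _ => mean_mono _ fun x _ => ?_
        split_ifs with hT
        · rw [← mul_div_assoc, le_div_iff₀ (hQ0 y), one_mul, Real.exp_neg,
            ← div_eq_mul_inv, le_div_iff₀ (Real.exp_pos _), mul_comm]
          exact hT
        · positivity
    _ = Real.exp (-γ) * (1 + 2 * κ) ^ n := by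
        have h2 : ∀ y, mean (prodPMF fun _ : Fin n => P) (fun x => (memoryless W x y).toReal) =
            ((prodPMF fun _ : Fin n => P).bind (memoryless W) y).toReal := fun y => by
          rw [bind_toReal]; rfl
        simp only [mean_mul_right, h2]
        rw [prodPMF_bind_memoryless]
        have h3 : ∀ y : Fin n → Y, (prodPMF (fun _ : Fin n => P.bind W) y).toReal *
            (Real.exp (-γ) / (prodPMF (fun _ : Fin n => W x₀) y).toReal) =
            Real.exp (-γ) * ∏ i, ((P.bind W (y i)).toReal / (W x₀ (y i)).toReal) := by
          intro y
          rw [prodPMF_toReal, prodPMF_toReal, Finset.prod_div_distrib]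
          ring
        simp only [h3]
        rw [mean_mul_left, mean_prodPMF_prod (fun _ : Fin n => P.bind W)
          fun _ y => (P.bind W y).toReal / (W x₀ y).toReal, h1]
        simp
    _ ≤ Real.exp (-γ) * Real.exp (2 * κ) ^ n := by
        have : 0 ≤ κ := cost_nonneg _
        gcongr
        linarith [Real.add_one_le_exp (2 * κ)]
    _ = _ := by
        rw [← Real.exp_nat_mul, ← Real.exp_add]
        congr 1; ring

open scoped Classical in
/-- The probability that the transmitted codeword fails the likelihood-ratio test. -/
lemma miss_le (hq : ∀ y, W x₀ y ≠ 0) (P : PMF X) (γ : ℝ) {s : ℝ} (hs : 0 ≤ s) :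
    (mean (prodPMF fun _ : Fin n => P) fun x => mean (memoryless W x) fun y =>
        if Real.exp γ * (prodPMF (fun _ : Fin n => W x₀) y).toReal ≤ (memoryless W x y).toReal
          then (0 : ℝ) else 1) ≤
      Real.exp (s * γ) * (mean P fun x => mean (W x) fun y =>
        Real.exp (-(s * Real.log ((W x y).toReal / (W x₀ y).toReal)))) ^ n := by
  set ι : X → Y → ℝ := fun x y => Real.log ((W x y).toReal / (W x₀ y).toReal)
  have hq' := toReal_off_pos hq
  have hQ0 : ∀ y, 0 < (prodPMF (fun _ : Fin n => W x₀) y).toReal := fun y => by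
    rw [prodPMF_toReal]; exact Finset.prod_pos fun i _ => hq' _
  -- Chernoff bound: failing the test means that the information density `∑ ι` is at most `γ`. Only
  -- outputs of positive probability matter, so the logarithm of the product splits.
  calc _ ≤ mean (prodPMF fun _ : Fin n => P) (fun x => mean (memoryless W x) fun y =>
        Real.exp (s * γ) * ∏ i, Real.exp (-(s * ι (x i) (y i)))) := by
        refine mean_mono _ fun x _ => mean_mono _ fun y hy => ?_
        split_ifs with hT
        · positivity
        · rw [← Real.exp_sum, ← Real.exp_add]
          refine Real.one_le_exp ?_
          have hpos : 0 < (memoryless W x y).toReal :=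
            ENNReal.toReal_pos hy (PMF.apply_ne_top _ y)
          have hlog : ∑ i, ι (x i) (y i) ≤ γ := by
            have hi : ∀ i, (W (x i) (y i)).toReal ≠ 0 := by
              rw [memoryless, prodPMF_toReal] at hpos
              exact fun i => Finset.prod_ne_zero_iff.1 hpos.ne' i (Finset.mem_univ i)
            rw [← Real.log_prod fun i _ => div_ne_zero (hi i) (hq' _).ne', Finset.prod_div_distrib]
            have e1 : ∏ i, (W (x i) (y i)).toReal = (memoryless W x y).toReal := by
              rw [memoryless, prodPMF_toReal]
            have e2 : ∏ i, (W x₀ (y i)).toReal = (prodPMF (fun _ : Fin n => W x₀) y).toReal := by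
              rw [prodPMF_toReal]
            rw [e1, e2, Real.log_le_iff_le_exp (div_pos hpos (hQ0 y)), div_le_iff₀ (hQ0 y)]
            exact (not_le.1 hT).le
          rw [Finset.sum_neg_distrib, ← Finset.mul_sum]
          nlinarith [mul_le_mul_of_nonneg_left hlog hs]
    _ = _ := by
        simp only [mean_mul_left]
        congr 1
        have h1 : ∀ x : Fin n → X, mean (memoryless W x) (fun y =>
            ∏ i, Real.exp (-(s * ι (x i) (y i)))) =
            ∏ i, mean (W (x i)) (fun y => Real.exp (-(s * ι (x i) y))) := fun x =>
          mean_prodPMF_prod (fun i => W (x i)) fun i y => Real.exp (-(s * ι (x i) y))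
        simp only [h1]
        rw [mean_prodPMF_prod (fun _ : Fin n => P)
          fun _ x => mean (W x) fun y => Real.exp (-(s * ι x y))]
        simp [ι]

lemma one_add_mul_log_le {u : ℝ} (hu : |u| ≤ 1 / 2) :
    (1 + u) * Real.log (1 + u) ≤ u + u ^ 2 / 2 + 4 * (|u| * u ^ 2) := by
  have hu' := abs_le.1 hu
  have h := Real.abs_log_sub_add_sum_range_le (x := -u) (by rw [abs_neg]; linarith) 2
  simp only [Finset.sum_range_succ, Finset.sum_range_zero, abs_neg, sub_neg_eq_add] at h
  have h1 := (abs_le.1 h).2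
  have hc : |u| ^ 3 = |u| * u ^ 2 := by rw [pow_succ', sq_abs]
  have h2 : |u| ^ (2 + 1) / (1 - |u|) ≤ 2 * (|u| * u ^ 2) := by
    rw [div_le_iff₀ (by linarith), show 2 + 1 = 3 from rfl, hc]
    nlinarith [mul_nonneg (abs_nonneg u) (sq_nonneg u)]
  have h3 : Real.log (1 + u) ≤ u - u ^ 2 / 2 + 2 * (|u| * u ^ 2) := by
    norm_num at h1
    linarith
  have h4 : -u * u ^ 2 ≤ |u| * u ^ 2 := mul_le_mul_of_nonneg_right (neg_le_abs u) (sq_nonneg u)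
  have h5 : 0 ≤ |u| * u ^ 2 := by positivity
  nlinarith [mul_le_mul_of_nonneg_left h3 (by linarith : 0 ≤ 1 + u), mul_le_mul_of_nonneg_left
    (by linarith : 1 + u ≤ 3 / 2) h5]

/-- In the expansion of `(1 + u) log (1 + u)` the linear term cancels because the shift sums to
zero. The quadratic term is the cost, and the cubic one is absorbed in the factor `1 + 8 b`. -/
lemma relEntropy_bind_le (hq : ∀ y, W x₀ y ≠ 0) (P : PMF X) {b : ℝ} (hb : b ≤ 1 / 2)
    (hP : ∀ y, |shift W x₀ (fun x => (P x).toReal) y| / (W x₀ y).toReal ≤ b) :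
    (relEntropy (P.bind W) (W x₀)).toReal ≤ (1 + 8 * b) * cost W x₀ fun x => (P x).toReal := by
  set h := shift W x₀ fun x => (P x).toReal
  have hq' := toReal_off_pos hq
  have hterm : ∀ y, (P.bind W y).toReal * Real.log ((P.bind W y).toReal / (W x₀ y).toReal) ≤
      h y + (1 / 2 + 4 * b) * (h y ^ 2 / (W x₀ y).toReal) := by
    intro y
    have hy : (P.bind W y).toReal = (W x₀ y).toReal * (1 + h y / (W x₀ y).toReal) := by
      rw [mul_add, mul_div_cancel₀ _ (hq' y).ne', mul_one]
      have := bind_sub_eq_shift (W := W) (x₀ := x₀) P y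
      linarith
    have habs : |h y / (W x₀ y).toReal| ≤ b := by
      rw [abs_div, abs_of_pos (hq' y)]; exact hP y
    set u := h y / (W x₀ y).toReal
    have hu : h y = (W x₀ y).toReal * u := by
      simp only [u]; rw [mul_div_cancel₀ _ (hq' y).ne']
    rw [hy, mul_div_cancel_left₀ _ (hq' y).ne', mul_assoc]
    have h1 := one_add_mul_log_le (habs.trans hb)
    have h2 : |u| * u ^ 2 ≤ b * u ^ 2 := mul_le_mul_of_nonneg_right habs (sq_nonneg u)
    have h3 : h y ^ 2 / (W x₀ y).toReal = (W x₀ y).toReal * u ^ 2 := by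
      have := (hq' y).ne'
      rw [hu]; field_simp
    rw [h3, hu]
    calc _ ≤ (W x₀ y).toReal * (u + u ^ 2 / 2 + 4 * (b * u ^ 2)) :=
          mul_le_mul_of_nonneg_left (by linarith) (hq' y).le
      _ = _ := by ring
  rw [relEntropy_toReal _ _ hq]
  refine (Finset.sum_le_sum fun y _ => hterm y).trans ?_
  rw [Finset.sum_add_distrib, sum_shift, ← Finset.mul_sum, cost]
  refine le_of_eq ?_
  ring

/-- Time sharing between the off symbol and a distribution. -/
lemma exists_mix (x₀ : X) (P : PMF X) {α : ℝ} (h0 : 0 ≤ α) (h1 : α ≤ 1) :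
    ∃ P' : PMF X, ∀ f : X → ℝ, mean P' f = (1 - α) * f x₀ + α * mean P f := by
  classical
  obtain ⟨P', hP'⟩ := exists_pmf_toReal
    (ν := fun x => (1 - α) * (if x = x₀ then 1 else 0) + α * (P x).toReal) (by
      refine ⟨fun x => ?_, ?_⟩
      · have : (0 : ℝ) ≤ if x = x₀ then 1 else 0 := by split_ifs <;> simp
        have h2 : 0 ≤ 1 - α := by linarith
        have h3 : 0 ≤ (P x).toReal := ENNReal.toReal_nonneg
        positivity
      · rw [Finset.sum_add_distrib, ← Finset.mul_sum, ← Finset.mul_sum, sum_toReal]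
        simp)
  refine ⟨P', fun f => ?_⟩
  simp only [mean, hP', add_mul, Finset.sum_add_distrib, mul_assoc, ← Finset.mul_sum]
  simp

open scoped Classical in
-- The quadratic error is absent at `x₀`, where the log-likelihood ratio vanishes identically. After
-- mixing, this error therefore carries the small factor `α`, and a fixed `s` can be used in the
-- Chernoff bound.
lemma exists_mean_exp_le (hq : ∀ y, W x₀ y ≠ 0) :
    ∃ J : ℝ, 0 ≤ J ∧ ∀ s : ℝ, 0 ≤ s → s * J ≤ 1 → ∀ x,
      mean (W x) (fun y => Real.exp (-(s * Real.log ((W x y).toReal / (W x₀ y).toReal)))) ≤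
        1 + (-(s * gain W x₀ x) + if x = x₀ then 0 else s ^ 2 * J ^ 2) := by
  set ι : X → Y → ℝ := fun x y => Real.log ((W x y).toReal / (W x₀ y).toReal)
  -- The sum is finite even where `W(y|x) = 0`, since `log 0 = 0`; such outputs carry no weight.
  set J := ∑ x, ∑ y, |ι x y|
  have hJ : ∀ x y, |ι x y| ≤ J := fun x y =>
    (Finset.single_le_sum (f := fun y => |ι x y|) (fun y _ => abs_nonneg _)
      (Finset.mem_univ y)).trans
    (Finset.single_le_sum (f := fun x => ∑ y, |ι x y|)
      (fun x _ => Finset.sum_nonneg fun y _ => abs_nonneg _) (Finset.mem_univ x))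
  have hJ0 : 0 ≤ J := Finset.sum_nonneg fun x _ => Finset.sum_nonneg fun y _ => abs_nonneg _
  refine ⟨J, hJ0, fun s hs hsJ x => ?_⟩
  by_cases hx : x = x₀
  · subst hx
    have : ∀ y, ι x y = 0 := fun y => by
      simp only [ι]; rw [div_self (toReal_off_pos hq y).ne', Real.log_one]
    simp only [ι] at this
    simp [this, gain_off hq]
  · rw [if_neg hx, gain, relEntropy_toReal _ _ hq]
    calc _ ≤ mean (W x) (fun y => 1 + -s * ι x y + s ^ 2 * J ^ 2) := by
          refine mean_mono _ fun y _ => ?_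
          have habs : |-(s * ι x y)| ≤ s * J := by
            rw [abs_neg, abs_mul, abs_of_nonneg hs]
            exact mul_le_mul_of_nonneg_left (hJ x y) hs
          have h1 := (abs_le.1 (Real.abs_exp_sub_one_sub_id_le (habs.trans hsJ))).2
          have h2 : (-(s * ι x y)) ^ 2 ≤ (s * J) ^ 2 := by
            rw [← sq_abs]; exact pow_le_pow_left₀ (abs_nonneg _) habs 2
          have h3 : (s * J) ^ 2 = s ^ 2 * J ^ 2 := mul_pow _ _ _
          simp only [ι] at h1 h2 ⊢
          linarith
      _ = _ := by
          rw [mean_add, mean_add, mean_const, mean_const, mean_mul_left]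
          ring

/-- The finite-blocklength achievability bound. -/
lemma achievable_of_bounds (hq : ∀ y, W x₀ y ≠ 0) {G : ℝ}
    (hG : ∀ ν : X → ℝ, (∀ x, 0 ≤ ν x) → ∀ y,
      |shift W x₀ ν y| / (W x₀ y).toReal ≤ G * √(cost W x₀ ν))
    {P : PMF X} (hP : P x₀ = 0) :
    ∃ J : ℝ, 0 ≤ J ∧ ∀ (n : ℕ) (α γ r s δ ε : ℝ), 0 ≤ α → α ≤ 1 → 0 ≤ s → s * J ≤ 1 → 0 ≤ r →
      G * (α * √(cost W x₀ fun x => (P x).toReal)) ≤ 1 / 2 →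
      (n : ℝ) * ((1 + 8 * (G * (α * √(cost W x₀ fun x => (P x).toReal)))) *
        (α ^ 2 * cost W x₀ fun x => (P x).toReal)) ≤ δ →
      Real.exp (s * γ - n * (α * (s * mean P (gain W x₀) - s ^ 2 * J ^ 2))) +
        2 * Real.exp (r - γ + 2 * (n * (α ^ 2 * cost W x₀ fun x => (P x).toReal))) ≤ ε →
      Achievable W x₀ δ ε n ⌈Real.exp r⌉₊ := by
  classical
  obtain ⟨J, hJ0, hJ⟩ := exists_mean_exp_le (W := W) hq
  refine ⟨J, hJ0, fun n α γ r s δ ε hα hα1 hs hsJ hr hb hδ hε => ?_⟩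
  obtain ⟨P', hP'⟩ := exists_mix x₀ P hα hα1
  have hsh : ∀ y, shift W x₀ (fun x => (P' x).toReal) y =
      shift W x₀ (fun x => α * (P x).toReal) y := by
    intro y
    rw [shift_smul]
    have := hP' fun x => (W x y).toReal - (W x₀ y).toReal
    simpa [shift, mean] using this
  have hcost : cost W x₀ (fun x => (P' x).toReal) =
      α ^ 2 * cost W x₀ fun x => (P x).toReal := by
    rw [← cost_smul]
    simp only [cost, hsh]
  set κ := cost W x₀ fun x => (P x).toReal
  set N := ⌈Real.exp r⌉₊
  have hN : NeZero N := ⟨(Nat.ceil_pos.2 (Real.exp_pos r)).ne'⟩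
  -- The rounding up of `exp r` accounts for the factor `2` in the error bound; it uses `r ≥ 0`.
  have hN2 : (N : ℝ) ≤ 2 * Real.exp r := by
    have := Nat.ceil_lt_add_one (Real.exp_pos r).le
    have := Real.one_le_exp hr
    linarith
  obtain ⟨C, hC, hE⟩ := exists_randomCode W (prodPMF fun _ : Fin n => P')
    (fun x y => Real.exp γ * (prodPMF (fun _ : Fin n => W x₀) y).toReal ≤
      (memoryless W x y).toReal) N
  refine ⟨hN, C, ?_, ?_⟩
  · have hsup : ∀ y, |shift W x₀ (fun x => (P' x).toReal) y| / (W x₀ y).toReal ≤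
        G * (α * √κ) := by
      intro y
      have := hG (fun x => (P' x).toReal) (fun x => ENNReal.toReal_nonneg) y
      rwa [hcost, Real.sqrt_mul (sq_nonneg _), Real.sqrt_sq hα] at this
    rw [hC, prodPMF_bind_memoryless,
      ← ENNReal.ofReal_toReal (relEntropy_ne_top _ _ (prodPMF_ne_zero fun _ => hq))]
    refine ENNReal.ofReal_le_ofReal ?_
    rw [relEntropy_prodPMF _ _ fun _ => hq]
    have h1 := relEntropy_bind_le hq P' hb hsup
    rw [hcost] at h1
    refine le_trans ?_ hδ
    simpa using mul_le_mul_of_nonneg_left h1 (Nat.cast_nonneg n)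
  · have hne : errorProb W C ≠ ∞ := by
      refine ne_top_of_le_ne_top ENNReal.one_ne_top ?_
      rw [errorProb]
      let _ : MeasurableSpace (Fin N × (Fin n → Y) × Fin N) := ⊤
      exact (PMF.toOuterMeasure_apply_le_toMeasure_apply _ _).trans MeasureTheory.prob_le_one
    rw [← ENNReal.ofReal_toReal hne]
    refine ENNReal.ofReal_le_ofReal (hE.trans (le_trans (add_le_add ?_ ?_) hε))
    · refine (miss_le hq P' γ hs).trans ?_
      have h1 : (mean P' fun x => mean (W x) fun y =>
          Real.exp (-(s * Real.log ((W x y).toReal / (W x₀ y).toReal)))) ≤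
          1 + α * (-(s * mean P (gain W x₀)) + s ^ 2 * J ^ 2) := by
        refine (mean_mono _ fun x _ => hJ s hs hsJ x).trans (le_of_eq ?_)
        rw [hP', gain_off hq]
        have h2 : mean P (fun x => 1 + (-(s * gain W x₀ x) +
            if x = x₀ then 0 else s ^ 2 * J ^ 2)) =
            mean P (fun x => 1 + (-s * gain W x₀ x + s ^ 2 * J ^ 2)) := by
          refine mean_congr P fun x hx => ?_
          rw [if_neg (fun h : x = x₀ => hx (h ▸ hP)), neg_mul]
        rw [h2, mean_add, mean_add, mean_const, mean_const, mean_mul_left]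
        simp
        ring
      calc _ ≤ Real.exp (s * γ) *
            Real.exp (α * (-(s * mean P (gain W x₀)) + s ^ 2 * J ^ 2)) ^ n := by
            gcongr
            · exact mean_nonneg _ fun x => mean_nonneg _ fun y => (Real.exp_pos _).le
            · linarith [Real.add_one_le_exp (α * (-(s * mean P (gain W x₀)) + s ^ 2 * J ^ 2))]
        _ = _ := by
            rw [← Real.exp_nat_mul, ← Real.exp_add]
            congr 1; ring
    · have h1 := false_alarm_le (n := n) hq P' γ
      rw [hcost] at h1
      calc _ ≤ 2 * Real.exp r * Real.exp (2 * (n * (α ^ 2 * κ)) - γ) := by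
            gcongr
            exact mean_nonneg _ fun y => mean_nonneg _ fun x => by split_ifs <;> simp
        _ = _ := by
            rw [mul_assoc, ← Real.exp_add]
            congr 2; ring

end Achievability

/-! ### Asymptotics in the blocklength -/

section Asymptotics

variable {X Y : Type*} [Fintype X] [Fintype Y] {W : X → PMF Y} {x₀ : X}

lemma tendsto_sqrt_natCast : Tendsto (fun n : ℕ => √(n : ℝ)) atTop atTop :=
  Real.tendsto_sqrt_atTop.comp tendsto_natCast_atTop_atTop

lemma eventually_achievable (hq : ∀ y, W x₀ y ≠ 0) {G : ℝ}
    (hG : ∀ ν : X → ℝ, (∀ x, 0 ≤ ν x) → ∀ y,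
      |shift W x₀ ν y| / (W x₀ y).toReal ≤ G * √(cost W x₀ ν))
    {P : PMF X} (hP : P x₀ = 0) (hD : 0 < mean P (gain W x₀))
    (hκ : 0 < cost W x₀ fun x => (P x).toReal) {η δ ε : ℝ} (hη : 0 < η) (hη2 : η < 1 / 2)
    (hδ : 0 < δ) (hε : 0 < ε) :
    ∀ᶠ n : ℕ in atTop, ∃ M : ℕ, Achievable W x₀ δ ε n M ∧
      (1 - 2 * η) * (1 - η) * ratio W x₀ P * √(n * δ) ≤ Real.log M := by
  obtain ⟨J, hJ0, hJ⟩ := achievable_of_bounds hq hG hP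
  have hratio : ratio W x₀ P = mean P (gain W x₀) / √(cost W x₀ fun x => (P x).toReal) :=
    ratio_eq P
  rw [hratio]
  set κ := cost W x₀ fun x => (P x).toReal
  set D := mean P (gain W x₀)
  have hκ' : 0 < √κ := Real.sqrt_pos.2 hκ
  have hδ' : 0 < √δ := Real.sqrt_pos.2 hδ
  -- With `α = a / √n` the divergence is `(1 - η)² δ` to leading order, strictly below `δ`, which
  -- leaves room for the vanishing correction.
  set a := (1 - η) * √δ / √κ
  have ha : 0 < a := div_pos (mul_pos (by linarith) hδ') hκ'
  have haκ : a ^ 2 * κ = (1 - η) ^ 2 * δ := by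
    simp only [a]
    rw [div_pow, mul_pow, Real.sq_sqrt hδ.le, Real.sq_sqrt hκ.le, div_mul_cancel₀ _ hκ.ne']
  -- A fixed small `s` keeps the miss exponent `a s (η D - s J²) √n` positive.
  obtain ⟨s, hs, hsJ, hsD⟩ : ∃ s : ℝ, 0 < s ∧ s * J ≤ 1 ∧ s * J ^ 2 < η * D := by
    have hc : ∀ c : ℝ, Tendsto (fun s : ℝ => s * c) (𝓝[>] 0) (𝓝 0) := fun c => by
      have : ContinuousAt (fun s : ℝ => s * c) 0 := by fun_prop
      simpa using this.tendsto.mono_left nhdsWithin_le_nhds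
    have h := (eventually_mem_nhdsWithin (a := (0 : ℝ)) (s := Set.Ioi 0)).and
      (((hc J).eventually_lt_const one_pos).and
        ((hc (J ^ 2)).eventually_lt_const (mul_pos hη hD)))
    obtain ⟨s, h1, h2, h3⟩ := h.exists
    exact ⟨s, h1, h2.le, h3⟩
  have hz := tendsto_sqrt_natCast
  have hα : Tendsto (fun n : ℕ => a / √(n : ℝ)) atTop (𝓝 0) := hz.const_div_atTop a
  have hGα : Tendsto (fun n : ℕ => G * (a / √(n : ℝ) * √κ)) atTop (𝓝 0) := by
    simpa using (hα.mul_const (√κ)).const_mul G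
  have hcost : Tendsto (fun n : ℕ => (1 + 8 * (G * (a / √(n : ℝ) * √κ))) * ((1 - η) ^ 2 * δ))
      atTop (𝓝 ((1 - η) ^ 2 * δ)) := by
    simpa using ((hGα.const_mul 8).const_add 1).mul_const ((1 - η) ^ 2 * δ)
  have hlt : (1 - η) ^ 2 * δ < δ := by
    have : (1 - η) ^ 2 < 1 := by nlinarith
    nlinarith
  have hexp : ∀ c b : ℝ, 0 < c →
      Tendsto (fun n : ℕ => Real.exp (b - c * √(n : ℝ))) atTop (𝓝 0) := by
    intro c b hc
    refine Real.tendsto_exp_atBot.comp ?_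
    simp only [sub_eq_add_neg]
    exact tendsto_atBot_add_const_left _ _ (tendsto_neg_atTop_atBot.comp (hz.const_mul_atTop hc))
  have herr : Tendsto (fun n : ℕ => Real.exp (0 - a * s * (η * D - s * J ^ 2) * √(n : ℝ)) +
      2 * Real.exp (2 * ((1 - η) ^ 2 * δ) - η * a * D * √(n : ℝ))) atTop (𝓝 0) := by
    simpa using (hexp (a * s * (η * D - s * J ^ 2)) 0
      (mul_pos (mul_pos ha hs) (by linarith))).add
      ((hexp (η * a * D) (2 * ((1 - η) ^ 2 * δ)) (by positivity)).const_mul 2)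
  filter_upwards [hα.eventually_lt_const one_pos,
    hGα.eventually_lt_const (by norm_num : (0 : ℝ) < 1 / 2), hcost.eventually_lt_const hlt,
    herr.eventually_lt_const hε, eventually_gt_atTop 0] with n h1 h2 h3 h4 hn
  have hn' : (0 : ℝ) < n := Nat.cast_pos.2 hn
  set z := √(n : ℝ)
  have hz0 : 0 < z := Real.sqrt_pos.2 hn'
  have hz2 : (n : ℝ) = z ^ 2 := (Real.sq_sqrt hn'.le).symm
  have hnα : (n : ℝ) * (a / z) = a * z := by rw [hz2]; field_simp
  have hnα2 : (n : ℝ) * ((a / z) ^ 2 * κ) = (1 - η) ^ 2 * δ := by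
    rw [← haκ, hz2]; field_simp
  -- The information density has mean `a z D`. The threshold `(1 - η) a z D` lies below it and the
  -- rate `r` below the threshold, each gap being `η a z D`, of order `√n`.
  set r := (1 - 2 * η) * (a * z * D)
  have hr : 0 ≤ r := mul_nonneg (by linarith) (by positivity)
  refine ⟨⌈Real.exp r⌉₊, hJ n (a / z) ((1 - η) * (a * z * D)) r s δ ε (by positivity) h1.le hs.le
    hsJ hr h2.le ?_ ?_, ?_⟩
  · refine le_trans (le_of_eq ?_) h3.le
    rw [← hnα2]; ring
  · refine le_trans (le_of_eq ?_) h4.le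
    have e1 : s * ((1 - η) * (a * z * D)) - n * (a / z * (s * D - s ^ 2 * J ^ 2)) =
        0 - a * s * (η * D - s * J ^ 2) * z := by
      rw [← mul_assoc (n : ℝ), hnα]; ring
    have e2 : r - (1 - η) * (a * z * D) + 2 * (n * ((a / z) ^ 2 * κ)) =
        2 * ((1 - η) ^ 2 * δ) - η * a * D * z := by
      rw [hnα2]; simp only [r]; ring
    rw [e1, e2]
  · have hlog : r ≤ Real.log ⌈Real.exp r⌉₊ := by
      rw [Real.le_log_iff_exp_le (Nat.cast_pos.2 (Nat.ceil_pos.2 (Real.exp_pos r)))]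
      exact Nat.le_ceil _
    refine le_trans (le_of_eq ?_) hlog
    rw [Real.sqrt_mul hn'.le]
    simp only [r, a, z]
    field_simp

lemma le_maxLogSize_div {n M : ℕ} {δ ε b : ℝ} (hn : 0 < n) (hδ : 0 < δ)
    (hA : Achievable W x₀ δ ε n M) (hb : b * √(n * δ) ≤ Real.log M) :
    (b : EReal) ≤ maxLogSize W x₀ n δ ε / ((√(n * δ) : ℝ) : EReal) := by
  have hpos : 0 < √(n * δ) := Real.sqrt_pos.2 (mul_pos (Nat.cast_pos.2 hn) hδ)
  rw [EReal.le_div_iff_mul_le (EReal.coe_pos.2 hpos) (EReal.coe_ne_top _), ← EReal.coe_mul]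
  exact (EReal.coe_le_coe_iff.2 hb).trans (le_sSup ⟨M, hA, rfl⟩)

lemma maxLogSize_div_le {n : ℕ} {δ ε b : ℝ} (hn : 0 < n) (hδ : 0 < δ)
    (h : ∀ M : ℕ, Achievable W x₀ δ ε n M → Real.log M ≤ b * √(n * δ)) :
    maxLogSize W x₀ n δ ε / ((√(n * δ) : ℝ) : EReal) ≤ b := by
  have hpos : 0 < √(n * δ) := Real.sqrt_pos.2 (mul_pos (Nat.cast_pos.2 hn) hδ)
  rw [EReal.div_le_iff_le_mul (EReal.coe_pos.2 hpos) (EReal.coe_ne_top _), ← EReal.coe_mul,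
    mul_comm]
  refine sSup_le ?_
  rintro _ ⟨M, hA, rfl⟩
  exact EReal.coe_le_coe_iff.2 (h M hA)

lemma le_liminf_maxLogSize (hq : ∀ y, W x₀ y ≠ 0) {G : ℝ}
    (hG : ∀ ν : X → ℝ, (∀ x, 0 ≤ ν x) → ∀ y,
      |shift W x₀ ν y| / (W x₀ y).toReal ≤ G * √(cost W x₀ ν))
    {P : PMF X} (hP : P x₀ = 0) (hD : 0 < mean P (gain W x₀))
    (hκ : 0 < cost W x₀ fun x => (P x).toReal) {δ ε : ℝ} (hδ : 0 < δ) (hε : 0 < ε) :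
    ((ratio W x₀ P : ℝ) : EReal) ≤
      liminf (fun n : ℕ => maxLogSize W x₀ n δ ε / ((√(n * δ) : ℝ) : EReal)) atTop := by
  refine le_of_forall_lt_imp_le_of_dense fun c hc => ?_
  obtain ⟨b, hcb, hb⟩ := EReal.lt_iff_exists_real_btwn.1 hc
  refine hcb.le.trans ?_
  rw [EReal.coe_lt_coe_iff] at hb
  have hcont : Tendsto (fun η : ℝ => (1 - 2 * η) * (1 - η) * ratio W x₀ P) (𝓝[>] 0)
      (𝓝 (ratio W x₀ P)) := by
    have : ContinuousAt (fun η : ℝ => (1 - 2 * η) * (1 - η) * ratio W x₀ P) 0 := by fun_prop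
    simpa using this.tendsto.mono_left nhdsWithin_le_nhds
  obtain ⟨η, h1, h2, h3⟩ := ((hcont.eventually_const_lt hb).and
    ((eventually_mem_nhdsWithin (a := (0 : ℝ)) (s := Set.Ioi 0)).and
      (((continuous_id.tendsto (0 : ℝ)).mono_left nhdsWithin_le_nhds).eventually_lt_const
        (by norm_num : (0 : ℝ) < 1 / 2)))).exists
  refine le_liminf_of_le (by isBoundedDefault) ?_
  filter_upwards [eventually_achievable hq hG hP hD hκ h2 h3 hδ hε, eventually_gt_atTop 0]
    with n hA hn
  obtain ⟨M, hM, hlog⟩ := hA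
  exact le_maxLogSize_div hn hδ hM
    ((mul_le_mul_of_nonneg_right h1.le (Real.sqrt_nonneg _)).trans hlog)

/-- The converse is weak: at fixed `ε` the factor `1 / (1 - ε)` survives the limit in `n`, and
disappears only as `ε ↓ 0`. -/
lemma liminf_maxLogSize_le (hq : ∀ y, W x₀ y ≠ 0) (hred : ¬ Redundant W x₀) {L : ℝ} (hL0 : 0 ≤ L)
    (hL : ∀ P : PMF X, P x₀ = 0 → ratio W x₀ P ≤ L) {δ ε : ℝ} (hδ : 0 < δ) (hε : 0 ≤ ε)
    (hε1 : ε < 1) :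
    liminf (fun n : ℕ => maxLogSize W x₀ n δ ε / ((√(n * δ) : ℝ) : EReal)) atTop ≤
      ((L / (1 - ε) : ℝ) : EReal) := by
  obtain ⟨G, hG0, hG⟩ := log_card_le hq hred hL0 hL hδ
  have hs : Tendsto (fun n : ℕ => √(δ / n) * G) atTop (𝓝 0) := by
    have h1 : Tendsto (fun n : ℕ => δ / (n : ℝ)) atTop (𝓝 0) :=
      tendsto_natCast_atTop_atTop.const_div_atTop δ
    simpa using ((Real.continuous_sqrt.tendsto 0).comp h1).mul_const G
  have hz : Tendsto (fun n : ℕ => 1 / √(n * δ)) atTop (𝓝 0) :=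
    (Real.tendsto_sqrt_atTop.comp
      (tendsto_natCast_atTop_atTop.atTop_mul_const hδ)).const_div_atTop 1
  have hu : Tendsto (fun n : ℕ => (L * (1 + √(δ / n) * G) + 1 / √(n * δ)) / (1 - ε)) atTop
      (𝓝 (L / (1 - ε))) := by
    simpa using (((hs.const_add 1).const_mul L).add hz).div_const (1 - ε)
  have hu' := (continuous_coe_real_ereal.tendsto (L / (1 - ε))).comp hu
  rw [← hu'.liminf_eq]
  refine liminf_le_liminf ?_ (by isBoundedDefault) (by isBoundedDefault)
  filter_upwards [hs.eventually_lt_const one_pos, eventually_gt_atTop 0] with n h1 hn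
  refine maxLogSize_div_le hn hδ fun M hA => (hG n M ε hn hε hε1 h1.le hA).trans (le_of_eq ?_)
  have hpos : 0 < √(n * δ) := Real.sqrt_pos.2 (mul_pos (Nat.cast_pos.2 hn) hδ)
  have : 1 - ε ≠ 0 := by linarith
  field_simp

end Asymptotics

end LPD

end

theorem theorem2 {X Y : Type*} [Fintype X] [Fintype Y] (W : X → PMF Y) (x₀ : X)
    (hsupp : (W x₀).support = Set.univ)
    (hred : ¬ LPD.Redundant W x₀)
    (hother : ∃ x : X, x ≠ x₀) :
    ∃ L : ℝ, 0 < L ∧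
      (∀ δ : ℝ, 0 < δ → LPD.IsScalingConstant W x₀ δ (L : EReal)) ∧
      IsGreatest {r : ℝ | ∃ P : PMF X, P x₀ = 0 ∧ r = LPD.ratio W x₀ P} L := by
  have hq : ∀ y, W x₀ y ≠ 0 := fun y => (PMF.mem_support_iff _ _).1 (hsupp ▸ Set.mem_univ y)
  obtain ⟨P, hP, hpos, hmax⟩ := LPD.exists_isGreatest_ratio hq hred hother
  refine ⟨LPD.ratio W x₀ P, hpos, fun δ hδ => ?_, ⟨P, hP, rfl⟩, ?_⟩
  · obtain ⟨G, -, hG⟩ := LPD.exists_abs_shift_div_le hq hred hmax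
    have hr := hpos
    rw [LPD.ratio_eq] at hr
    -- If the cost were zero, the ratio would be a division by zero, hence `0`, against its
    -- positivity.
    have hκ : 0 < LPD.cost W x₀ fun x => (P x).toReal := by
      refine (LPD.cost_nonneg _).lt_of_ne' fun h => ?_
      rw [h, Real.sqrt_zero, div_zero] at hr
      exact hr.false
    have hD : 0 < LPD.mean P (LPD.gain W x₀) :=
      (div_pos_iff_of_pos_right (Real.sqrt_pos.2 hκ)).1 hr
    have hup : Tendsto (fun ε : ℝ => ((LPD.ratio W x₀ P / (1 - ε) : ℝ) : EReal)) (𝓝[>] 0)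
        (𝓝 ((LPD.ratio W x₀ P : ℝ) : EReal)) := by
      have h : ContinuousAt (fun ε : ℝ => LPD.ratio W x₀ P / (1 - ε)) 0 :=
        ContinuousAt.div (by fun_prop) (by fun_prop) (by norm_num)
      have h' : Tendsto (fun ε : ℝ => LPD.ratio W x₀ P / (1 - ε)) (𝓝[>] 0)
          (𝓝 (LPD.ratio W x₀ P)) := by
        simpa using h.tendsto.mono_left nhdsWithin_le_nhds
      exact (continuous_coe_real_ereal.tendsto _).comp h'
    have hε : ∀ᶠ ε : ℝ in 𝓝[>] 0, 0 < ε := eventually_mem_nhdsWithin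
    have hε1 : ∀ᶠ ε : ℝ in 𝓝[>] 0, ε < 1 :=
      ((continuous_id.tendsto (0 : ℝ)).mono_left nhdsWithin_le_nhds).eventually_lt_const one_pos
    -- Squeeze: the lower bound holds for every `ε > 0` without loss, and the upper bound loses only
    -- `1 / (1 - ε)`.
    refine tendsto_of_tendsto_of_tendsto_of_le_of_le' tendsto_const_nhds hup ?_ ?_
    · filter_upwards [hε] with ε h
      exact LPD.le_liminf_maxLogSize hq hG hP hD hκ hδ h
    · filter_upwards [hε, hε1] with ε h h1
      exact LPD.liminf_maxLogSize_le hq hred hpos.le hmax hδ h.le h1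
  · rintro _ ⟨P', hP', rfl⟩
    exact hmax P' hP'
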